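/- Digraphs are finite and have no parallel arcs. A digraph is strict if it has no loops. Its order is its number of vertices and its size is its number of arcs. For $k\ge 1$, a digraph is $\mathscr F_k$-free if it has no two distinct directed walks of length $k$ (vertices and arcs may repeat) with the same initial vertex and the same terminal vertex. Let $ex(n,\mathscr F_k)$ be the maximum size of an $\mathscr F_k$-free strict digraph of order $n$, and let $Ex(n,\mathscr F_k)$ be the set of $\mathscr F_k$-free strict digraphs of order $n$ and size $ex(n,\mathscr F_k)$. Let $T_k$ be the $k\times k$ matrix with ones strictly above the diagonal and zeros elsewhere, let $J_m$ be the $m\times m$ all-ones matrix, and let $\Pi_{m,k}=J_m\otimes T_k$, an $m\times m$ array of blocks $T_k$. For integers $s\ge 0$ and $0\le t<k$, a digraph of order $sk+t$ is an $(s,k,t)$-completely transitive tournament if its adjacency matrix is permutation similar to the principal submatrix of $\Pi_{s+1,k}$ obtained by deleting the rows and columns with indices in some set $\alpha\subseteq\{sk+1,\dots,sk+k\}$ with $|\alpha|=k-t$. **Theorem.** Let $n=sk+t$, where $s,k,t$ are nonnegative integers with $t<k$. If $n\ge k+4\ge 8$, then $$ex(n,\mathscr F_k)=\binom n2-\binom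 s2 k-st.$$ Moreover, if $n\ge k+5\ge 10$, then a digraph $D$ of order $n$ is in $Ex(n,\mathscr F_k)$ if and only if $D$ is an $(s,k,t)$-completely transitive tournament. Both assertions also hold when $ex(n,\mathscr F_k)$ and $Ex(n,\mathscr F_k)$ are defined with all digraphs, loops permitted, in place of strict digraphs. -/

import Mathlib

open scoped Kronecker

namespace WalkTuran

/-- A digraph is strict if it has no loops. (Parallel arcs are excluded in every `Digraph`, since
adjacency is a relation.) -/
def IsStrict {V : Type*} (D : Digraph V) : Prop := ∀ v, ¬ D.Adj v v

/-- A directed walk of length `k` in `D`, given by its sequence `p 0, …, p k` of vertices, which may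
repeat. As there are no parallel arcs, the vertex sequence determines the walk. -/
def IsWalk {V : Type*} (D : Digraph V) (k : ℕ) (p : Fin (k + 1) → V) : Prop :=
  ∀ i : Fin k, D.Adj (p i.castSucc) (p i.succ)

/-- `D` is `F_k`-free: there are no two distinct walks of length `k` in `D` that have the same
initial vertex and the same terminal vertex. -/
def IsFree {V : Type*} (D : Digraph V) (k : ℕ) : Prop :=
  ¬ ∃ p q : Fin (k + 1) → V, IsWalk D k p ∧ IsWalk D k q ∧ p ≠ q ∧
    p 0 = q 0 ∧ p (Fin.last k) = q (Fin.last k)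

/-- The size of a digraph: its number of arcs. -/
noncomputable def size {V : Type*} (D : Digraph V) : ℕ :=
  {a : V × V | D.Adj a.1 a.2}.ncard

/-- The `F_k`-free digraphs on `n` vertices, loops permitted. -/
def free (n k : ℕ) : Set (Digraph (Fin n)) := {D | IsFree D k}

/-- The `F_k`-free strict digraphs on `n` vertices. -/
def strictFree (n k : ℕ) : Set (Digraph (Fin n)) := {D | IsStrict D ∧ IsFree D k}

/-- The maximum size of a digraph in the class `𝒞`. -/
noncomputable def maxSize {n : ℕ} (𝒞 : Set (Digraph (Fin n))) : ℕ := sSup (size '' 𝒞)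

/-- The digraphs in the class `𝒞` whose size is the maximum. -/
def extremal {n : ℕ} (𝒞 : Set (Digraph (Fin n))) : Set (Digraph (Fin n)) :=
  {D | D ∈ 𝒞 ∧ size D = maxSize 𝒞}

/-- `ex(n, F_k)` for strict digraphs. -/
noncomputable def ex (n k : ℕ) : ℕ := maxSize (strictFree n k)

/-- `Ex(n, F_k)` for strict digraphs. -/
def Ex (n k : ℕ) : Set (Digraph (Fin n)) := extremal (strictFree n k)

/-- `ex(n, F_k)` for digraphs in which loops are permitted. -/
noncomputable def exLoop (n k : ℕ) : ℕ := maxSize (free n k)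

/-- `Ex(n, F_k)` for digraphs in which loops are permitted. -/
def ExLoop (n k : ℕ) : Set (Digraph (Fin n)) := extremal (free n k)

/-- The supremum defining `maxSize` is an attained maximum. -/
theorem isGreatest_maxSize {n : ℕ} {𝒞 : Set (Digraph (Fin n))} (h : 𝒞.Nonempty) :
    IsGreatest (size '' 𝒞) (maxSize 𝒞) := by
  have hb : BddAbove (size '' 𝒞) := by
    refine ⟨(Set.univ : Set (Fin n × Fin n)).ncard, ?_⟩
    rintro _ ⟨D, -, rfl⟩
    exact Set.ncard_le_ncard (Set.subset_univ _) (Set.toFinite _)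
  exact ⟨Nat.sSup_mem (h.image _) hb, fun _ hx => le_csSup hb hx⟩

/-- The digraph without arcs lies in both classes, so these are nonempty. -/
theorem strictFree_nonempty (n k : ℕ) : (strictFree n k).Nonempty := by
  refine ⟨⊥, fun v h => h, ?_⟩
  rintro ⟨p, q, hp, -, hpq, h0, -⟩
  rcases k with _ | k
  · exact hpq (funext fun i => by rw [Fin.eq_zero i]; exact h0)
  · exact hp 0

theorem strictFree_subset_free (n k : ℕ) : strictFree n k ⊆ free n k := fun _ h => h.2

open Classical in
/-- The adjacency matrix of a digraph. -/
noncomputable def adjMatrix {V : Type*} (D : Digraph V) : Matrix V V ℕ :=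
  Matrix.of fun i j => if D.Adj i j then 1 else 0

/-- The upper triangular tournament matrix `T_n`: ones strictly above the diagonal. -/
def T (n : ℕ) : Matrix (Fin n) (Fin n) ℕ := Matrix.of fun i j => if i < j then 1 else 0

/-- The all-ones matrix `J_m`. -/
def J (m : ℕ) : Matrix (Fin m) (Fin m) ℕ := Matrix.of fun _ _ => 1

/-- `Π_{m,n} = J_m ⊗ T_n`. The index `(a, i)` stands for position `i` in block `a`. -/
def Pi (m n : ℕ) : Matrix (Fin m × Fin n) (Fin m × Fin n) ℕ := J m ⊗ₖ T n

/-- The principal submatrix `A(α)`, obtained by deleting the rows and columns with index in `α`. -/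
def deletion {ι : Type*} (A : Matrix ι ι ℕ) (α : Finset ι) :
    Matrix {i // i ∉ α} {i // i ∉ α} ℕ :=
  A.submatrix Subtype.val Subtype.val

/-- Permutation similarity: `A` and `B` agree after a simultaneous renumbering of the rows and
columns. -/
def PermSimilar {ι κ : Type*} (A : Matrix ι ι ℕ) (B : Matrix κ κ ℕ) : Prop :=
  ∃ e : ι ≃ κ, A = B.submatrix e e

/-- `D` is an `(m, n, t)`-completely transitive tournament (for `t < n`): its adjacency matrix is
permutation similar to a matrix obtained from `Π_{m+1,n}` by deleting `n - t` rows and the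
corresponding columns, all of them from the last of the `m + 1` blocks. -/
def IsCompletelyTransitive {V : Type*} (m n t : ℕ) (D : Digraph V) : Prop :=
  ∃ α : Finset (Fin (m + 1) × Fin n),
    (∀ x ∈ α, x.1 = Fin.last m) ∧ α.card + t = n ∧
      PermSimilar (adjMatrix D) (deletion (Pi (m + 1) n) α)

end WalkTuran

/-! In a completely transitive tournament all arcs go from a lower to a higher one of `k` levels, so
there is no walk of length `k` at all, and the size is that of a Turán graph with `k` parts,
`turanSize k n`.

Call C(|A|,2) minus the number of arcs inside `A` the deficit of `A`. From four vertices on it is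
nonnegative, because loops and 2-cycles cost at least as many arcs as they bring; from five vertices
on, deficit zero forces a transitive tournament (`WalkUnique.arcs_bound`). Most contradictions have
one source: a walk of length `k + 1` on which either of two inner vertices can be skipped gives two
walks of length `k` with the same ends (`WalkUnique.skip`).

By averaging, deletion of a suitable vertex lowers a positive deficit (`exists_erase_choose`). Hence
the deficit is at least 1, 2, 4 at the orders `k + 2`, `k + 3`, `k + 4`. The last value comes from a
transitive tournament `K` of order `k + 1`: a vertex joined to `k` vertices of `K` is a twin of one
of its ends, among three such vertices two are twins of the same end, and these are not adjacent. A
finer averaging (`exists_erase_turanSize`) carries an excess over `turanSize` down to order `k + 4`,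
where it is impossible.

For equality at order `k + 5`, where the deficit is 5, deletions lead to a transitive tournament of
order `k`. Counting shows that each of the five other vertices misses exactly one of its vertices,
and `IsExtremalFive.twin` makes it a twin of that vertex; this yields the levels. For larger orders
a vertex is deleted so that an extremal digraph remains, and degree considerations put it back on
one of the smallest levels (`IsLeveled.exists_insert`). The upper bounds never assume that loops are
absent, so both versions of the theorem come out together. -/

namespace WalkTuran

open Finset

/-- Two walks of length `k` with common ends agree; a walk is a sequence `ℕ → V`, of which the
terms up to `k` matter. -/
def WalkUnique {V : Type*} (R : V → V → Prop) (k : ℕ) : Prop :=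
  ∀ f g : ℕ → V, (∀ i < k, R (f i) (f (i + 1))) → (∀ i < k, R (g i) (g (i + 1))) →
    f 0 = g 0 → f k = g k → ∀ i ≤ k, f i = g i

/-- There is an infinite walk that starts at `v`. -/
def Escapes {V : Type*} (R : V → V → Prop) (v : V) : Prop :=
  ∃ z : ℕ → V, z 0 = v ∧ ∀ i, R (z i) (z (i + 1))

/-! ### Walks with common ends -/

section Walks

variable {V : Type*} {R : V → V → Prop} {k : ℕ}

theorem IsFree.walkUnique {D : Digraph V} (h : IsFree D k) : WalkUnique D.Adj k := by
  intro f g hf hg h0 hk i hi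
  by_contra hne
  refine h ⟨fun j => f j, fun j => g j, fun j => ?_, fun j => ?_, ?_, ?_, ?_⟩
  · simpa using hf j j.2
  · simpa using hg j j.2
  · intro he
    exact hne (congrFun he ⟨i, by omega⟩)
  · simpa using h0
  · simpa using hk

/-- Reversal of all arcs saves half of the later cases: out-neighbours are exchanged with
in-neighbours, first vertices with last ones. -/
theorem WalkUnique.flip (h : WalkUnique R k) : WalkUnique (flip R) k := by
  intro f g hf hg h0 hk i hi
  have := h (fun j => f (k - j)) (fun j => g (k - j))
    (fun j hj => by
      have := hf (k - (j + 1)) (by omega)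
      rwa [show k - (j + 1) + 1 = k - j by omega] at this)
    (fun j hj => by
      have := hg (k - (j + 1)) (by omega)
      rwa [show k - (j + 1) + 1 = k - j by omega] at this)
    (by simpa using hk) (by simpa using h0) (k - i) (by omega)
  simpa [show k - (k - i) = i by omega] using this

/-- Shorter walks are unique as well if they can be prolonged indefinitely. -/
theorem WalkUnique.of_escapes (h : WalkUnique R k) {l : ℕ} (hl : l ≤ k) {f g : ℕ → V}
    (hf : ∀ i < l, R (f i) (f (i + 1))) (hg : ∀ i < l, R (g i) (g (i + 1)))
    (h0 : f 0 = g 0) (hfg : f l = g l) (he : Escapes R (f l)) : ∀ i ≤ l, f i = g i := by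
  obtain ⟨z, hz, hw⟩ := he
  -- Both walks are continued along the same infinite walk and cut off at length `k`.
  have key : ∀ e : ℕ → V, (∀ i < l, R (e i) (e (i + 1))) → e l = z 0 →
      ∀ i < k, R ((fun t => if t ≤ l then e t else z (t - l)) i)
        ((fun t => if t ≤ l then e t else z (t - l)) (i + 1)) := by
    intro e hE hz i _
    rcases lt_trichotomy i l with hi | hi | hi
    · simp only [hi.le, Nat.succ_le_of_lt hi, if_true]
      exact hE i hi
    · subst hi
      simp only [le_refl, if_true, show ¬ i + 1 ≤ i by omega, if_false, hz,
        show i + 1 - i = 0 + 1 by omega]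
      exact hw 0
    · simp only [show ¬ i ≤ l by omega, show ¬ i + 1 ≤ l by omega, if_false,
        show i + 1 - l = i - l + 1 by omega]
      exact hw _
  intro i hi
  have := h _ _ (key f hf hz.symm) (key g hg (hfg ▸ hz.symm)) (by simpa using h0)
    (by
      by_cases hkl : k ≤ l
      · obtain rfl : k = l := le_antisymm hkl hl
        simpa using hfg
      · simp [hkl]) i (hi.trans hl)
  simpa [hi] using this

theorem Escapes.of_loop {x : V} (h : R x x) : Escapes R x := ⟨fun _ => x, rfl, fun _ => h⟩

theorem Escapes.of_two {x y : V} (h : R x y) (h' : R y x) : Escapes R x := by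
  refine ⟨fun n => if n % 2 = 0 then x else y, by simp, fun i => ?_⟩
  rcases Nat.mod_two_eq_zero_or_one i with hi | hi
  · simpa [hi, show (i + 1) % 2 = 1 by omega] using h
  · simpa [hi, show (i + 1) % 2 = 0 by omega] using h'

theorem Escapes.of_three {x y z : V} (h : R x y) (h' : R y z) (h'' : R z x) : Escapes R x := by
  refine ⟨fun n => if n % 3 = 0 then x else if n % 3 = 1 then y else z, by simp, fun i => ?_⟩
  have : i % 3 < 3 := Nat.mod_lt _ (by norm_num)
  rcases (show i % 3 = 0 ∨ i % 3 = 1 ∨ i % 3 = 2 by omega) with hi | hi | hi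
  · simpa [hi, show (i + 1) % 3 = 1 by omega] using h
  · simpa [hi, show (i + 1) % 3 = 2 by omega] using h'
  · simpa [hi, show (i + 1) % 3 = 0 by omega] using h''

/-- This and the next two are the instances of `WalkUnique.of_escapes` for a common end on a cycle
of length at most three. -/
theorem WalkUnique.two (h : WalkUnique R k) (hk : 2 ≤ k) {a b b' d : V} (he : Escapes R d)
    (h1 : R a b) (h2 : R b d) (h1' : R a b') (h2' : R b' d) : b = b' := by
  have := h.of_escapes hk (f := fun | 0 => a | 1 => b | _ => d)
    (g := fun | 0 => a | 1 => b' | _ => d)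
    (fun i hi => by interval_cases i <;> assumption)
    (fun i hi => by interval_cases i <;> assumption) rfl rfl he
  exact this 1 (by norm_num)

theorem WalkUnique.three (h : WalkUnique R k) (hk : 3 ≤ k) {a b c b' c' d : V} (he : Escapes R d)
    (h1 : R a b) (h2 : R b c) (h3 : R c d) (h1' : R a b') (h2' : R b' c') (h3' : R c' d) :
    b = b' ∧ c = c' := by
  have := h.of_escapes hk (f := fun | 0 => a | 1 => b | 2 => c | _ => d)
    (g := fun | 0 => a | 1 => b' | 2 => c' | _ => d)
    (fun i hi => by interval_cases i <;> assumption)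
    (fun i hi => by interval_cases i <;> assumption) rfl rfl he
  exact ⟨this 1 (by norm_num), this 2 (by norm_num)⟩

theorem WalkUnique.four (h : WalkUnique R k) (hk : 4 ≤ k) {a b c d b' c' d' e : V}
    (he : Escapes R e) (h1 : R a b) (h2 : R b c) (h3 : R c d) (h4 : R d e)
    (h1' : R a b') (h2' : R b' c') (h3' : R c' d') (h4' : R d' e) : b = b' := by
  have := h.of_escapes hk (f := fun | 0 => a | 1 => b | 2 => c | 3 => d | _ => e)
    (g := fun | 0 => a | 1 => b' | 2 => c' | 3 => d' | _ => e)
    (fun i hi => by interval_cases i <;> assumption)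
    (fun i hi => by interval_cases i <;> assumption) rfl rfl he
  exact this 1 (by norm_num)

/-- In a walk of length `k + 1` at most one inner vertex can be skipped. -/
theorem WalkUnique.skip (h : WalkUnique R k) {f : ℕ → V} (hf : ∀ i ≤ k, R (f i) (f (i + 1)))
    {a b : ℕ} (ha : 1 ≤ a) (hab : a < b) (hb : b ≤ k) (h1 : R (f (a - 1)) (f (a + 1)))
    (h2 : R (f (b - 1)) (f (b + 1))) : f a = f (a + 1) := by
  -- The walk that skips `f y`. At time `a`, the walk that skips `f b` is still at `f a`, the one
  -- that skips `f a` already at `f (a + 1)`.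
  have key : ∀ y, 1 ≤ y → y ≤ k → R (f (y - 1)) (f (y + 1)) →
      ∀ i < k, R ((fun t => if t < y then f t else f (t + 1)) i)
        ((fun t => if t < y then f t else f (t + 1)) (i + 1)) := by
    intro y hy hyk hR i hi
    rcases lt_trichotomy (i + 1) y with h' | h' | h'
    · simpa [h', show i < y by omega] using hf i hi.le
    · subst h'
      simpa using hR
    · simpa [show ¬ i + 1 < y by omega, show ¬ i < y by omega] using hf (i + 1) hi
  have := h _ _ (key a ha (by omega) h1) (key b (by omega) hb h2)
    (by simp [show 0 < a by omega, show 0 < b by omega])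
    (by simp [show ¬ k < a by omega, show ¬ k < b by omega]) a (by omega)
  simpa [hab] using this.symm

end Walks

/-! ### Counting arcs; transitive enumerations -/

section Arcs

variable {V : Type*} (R : V → V → Prop)

open Classical in
/-- The indicator of an arc. -/
noncomputable def ind (u v : V) : ℕ := if R u v then 1 else 0

/-- The number of arcs inside `A`. -/
noncomputable def arcs (A : Finset V) : ℕ := ∑ u ∈ A, ∑ v ∈ A, ind R u v

/-- The number of arcs between `v` and `A`, in either direction. -/
noncomputable def deg (v : V) (A : Finset V) : ℕ := ∑ u ∈ A, (ind R v u + ind R u v)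

variable {R}

theorem ind_le_one (u v : V) : ind R u v ≤ 1 := by unfold ind; split_ifs <;> simp

theorem ind_eq_one {u v : V} : ind R u v = 1 ↔ R u v := by unfold ind; split_ifs <;> simp [*]

theorem ind_eq_zero {u v : V} : ind R u v = 0 ↔ ¬ R u v := by unfold ind; split_ifs <;> simp [*]

theorem ind_flip (u v : V) : ind (flip R) u v = ind R v u := rfl

theorem arcs_empty : arcs R (∅ : Finset V) = 0 := rfl

theorem arcs_singleton (v : V) : arcs R {v} = ind R v v := by simp [arcs]

theorem sum_deg (A : Finset V) : ∑ v ∈ A, deg R v A = 2 * arcs R A := by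
  unfold deg arcs
  simp only [sum_add_distrib]
  rw [sum_comm (f := fun x y => ind R y x)]
  ring

theorem deg_le_card {A : Finset V} {v : V} (h : ∀ u ∈ A, R u v → ¬ R v u) :
    deg R v A ≤ A.card := by
  rw [card_eq_sum_ones]
  refine sum_le_sum fun u hu => ?_
  by_cases hR : R u v
  · rw [ind_eq_zero.2 (h u hu hR)]
    simpa using ind_le_one u v
  · rw [ind_eq_zero.2 hR]
    simpa using ind_le_one v u

/-- `p` lists `A` without repetition, in such a way that all arcs go forward that can. -/
structure IsTransEnum (R : V → V → Prop) (p : ℕ → V) (A : Finset V) : Prop where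
  adj : ∀ i j, i < j → j < A.card → R (p i) (p j)
  mem : ∀ i < A.card, p i ∈ A
  surj : ∀ v ∈ A, ∃ i < A.card, p i = v

theorem IsTransEnum.inj {p : ℕ → V} {A : Finset V} (h : IsTransEnum R p A) {i j : ℕ}
    (hi : i < A.card) (hj : j < A.card) (hij : p i = p j) : i = j := by
  have hs : Set.SurjOn p (range A.card : Finset ℕ) A := fun v hv => by
    obtain ⟨i, hi, rfl⟩ := h.surj v hv
    exact ⟨i, by simpa using hi, rfl⟩
  exact Finset.injOn_of_surjOn_of_card_le p (fun i hi => h.mem i (by simpa using hi)) hs (by simp)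
    (by simpa using hi) (by simpa using hj) hij

theorem IsTransEnum.sum {p : ℕ → V} {A : Finset V} (h : IsTransEnum R p A) (f : V → ℕ) :
    ∑ v ∈ A, f v = ∑ i ∈ range A.card, f (p i) := by
  symm
  refine sum_bij (fun i _ => p i) (fun i hi => h.mem i (by simpa using hi))
    (fun i hi j hj hij => h.inj (by simpa using hi) (by simpa using hj) hij)
    (fun v hv => ?_) (fun _ _ => rfl)
  obtain ⟨i, hi, rfl⟩ := h.surj v hv
  exact ⟨i, by simpa using hi, rfl⟩

theorem IsTransEnum.flip {p : ℕ → V} {A : Finset V} (h : IsTransEnum R p A) :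
    IsTransEnum (flip R) (fun i => p (A.card - 1 - i)) A where
  adj i j hij hj := h.adj _ _ (by omega) (by omega)
  mem i hi := h.mem _ (by omega)
  surj v hv := by
    obtain ⟨i, hi, rfl⟩ := h.surj v hv
    exact ⟨A.card - 1 - i, by omega, congrArg p (by omega)⟩

variable [DecidableEq V]

theorem arcs_union {A B : Finset V} (h : Disjoint A B) :
    arcs R (A ∪ B) = arcs R A + arcs R B + ∑ b ∈ B, deg R b A := by
  unfold arcs deg
  simp only [sum_union h, sum_add_distrib]
  rw [sum_comm (s := A) (t := B)]
  ring

theorem arcs_insert {A : Finset V} {v : V} (h : v ∉ A) :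
    arcs R (insert v A) = arcs R A + deg R v A + ind R v v := by
  have : insert v A = A ∪ {v} := by ext; simp
  rw [this, arcs_union (by simpa using h), arcs_singleton, sum_singleton]
  ring

theorem arcs_erase {A : Finset V} {v : V} (h : v ∈ A) :
    arcs R A = arcs R (A.erase v) + deg R v (A.erase v) + ind R v v := by
  rw [← arcs_insert (notMem_erase v A), insert_erase h]

theorem deg_insert {A : Finset V} {u v : V} (h : u ∉ A) :
    deg R v (insert u A) = ind R v u + ind R u v + deg R v A := by
  simp [deg, sum_insert h]

theorem deg_union {A B : Finset V} {v : V} (h : Disjoint A B) :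
    deg R v (A ∪ B) = deg R v A + deg R v B := sum_union h

theorem deg_erase {A : Finset V} {v : V} (h : v ∈ A) :
    deg R v A = deg R v (A.erase v) + 2 * ind R v v := by
  conv_lhs => rw [← insert_erase h]
  rw [deg_insert (notMem_erase v A)]
  ring

/-- An arc between different vertices survives all but two of the vertex deletions, a loop all but
one. -/
theorem card_mul_arcs_le (A : Finset V) :
    A.card * arcs R A ≤ ∑ v ∈ A, arcs R (A.erase v) + 2 * arcs R A := by
  rw [← sum_deg, ← sum_add_distrib, ← smul_eq_mul, ← sum_const]
  refine sum_le_sum fun v hv => ?_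
  rw [arcs_erase hv, deg_erase hv]
  omega

/-- A vertex can be inserted into a transitive enumeration. -/
theorem IsTransEnum.insert {p : ℕ → V} {A : Finset V} (h : IsTransEnum R p A) {v : V}
    (hv : v ∉ A) {a : ℕ} (ha : a ≤ A.card) (h1 : ∀ i < a, R (p i) v)
    (h2 : ∀ i, a ≤ i → i < A.card → R v (p i)) :
    IsTransEnum R (fun t => if t < a then p t else if t = a then v else p (t - 1))
      (insert v A) where
  adj i j hij hj := by
    rw [card_insert_of_notMem hv] at hj
    split_ifs <;> first | omega | skip
    · exact h.adj _ _ hij (by omega)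
    · exact h1 _ ‹_›
    · exact h.adj _ _ (by omega) (by omega)
    · exact h2 _ (by omega) (by omega)
    · exact h.adj _ _ (by omega) (by omega)
  mem i hi := by
    rw [card_insert_of_notMem hv] at hi
    split_ifs
    · exact mem_insert_of_mem (h.mem _ (by omega))
    · exact mem_insert_self _ _
    · exact mem_insert_of_mem (h.mem _ (by omega))
  surj u hu := by
    rw [card_insert_of_notMem hv]
    rcases mem_insert.1 hu with rfl | hu
    · exact ⟨a, by omega, by simp⟩
    · obtain ⟨i, hi, rfl⟩ := h.surj u hu
      by_cases hia : i < a
      · exact ⟨i, by omega, by simp [hia]⟩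
      · exact ⟨i + 1, by omega, by simp [show ¬ i + 1 < a by omega, show i + 1 ≠ a by omega]⟩

end Arcs

/-! ### Comparison with the size of a tournament -/

section Small

variable {V : Type*} {R : V → V → Prop} {k : ℕ}

/-- Inside `A` there are neither loops nor pairs of opposite arcs. -/
def Oriented (R : V → V → Prop) (A : Finset V) : Prop := ∀ u ∈ A, ∀ v ∈ A, R u v → ¬ R v u

theorem Oriented.mono {A B : Finset V} (h : Oriented R B) (hAB : A ⊆ B) : Oriented R A :=
  fun u hu v hv => h u (hAB hu) v (hAB hv)

theorem choose_two_succ (n : ℕ) : (n + 1).choose 2 = n.choose 2 + n := by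
  rw [Nat.choose_succ_succ' n 1, Nat.choose_one_right, add_comm]

theorem choose_two_add (a b : ℕ) : (a + b).choose 2 = a.choose 2 + b.choose 2 + a * b := by
  induction b with
  | zero => simp
  | succ b ih => rw [← add_assoc, choose_two_succ, choose_two_succ, ih]; ring

theorem arcs_eq_zero {A : Finset V} (h : ∀ u ∈ A, ∀ v ∈ A, ¬ R u v) : arcs R A = 0 :=
  sum_eq_zero fun u hu => sum_eq_zero fun v hv => ind_eq_zero.2 (h u hu v hv)

variable [DecidableEq V]

theorem Oriented.arcs_le {A : Finset V} (h : Oriented R A) : arcs R A ≤ A.card.choose 2 := by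
  induction A using Finset.induction_on with
  | empty => simp [arcs_empty]
  | insert v A hv ih =>
    rw [arcs_insert hv, card_insert_of_notMem hv, choose_two_succ]
    have h1 := ih (h.mono (subset_insert v A))
    have h2 : deg R v A ≤ A.card :=
      deg_le_card fun u hu => h u (mem_insert_of_mem hu) v (mem_insert_self v A)
    have h3 : ind R v v = 0 := ind_eq_zero.2 fun hv' =>
      h v (mem_insert_self v A) v (mem_insert_self v A) hv' hv'
    omega

theorem Oriented.arcs_lt {A : Finset V} (h : Oriented R A) {u v : V} (hu : u ∈ A) (hv : v ∈ A)
    (huv : u ≠ v) (h1 : ¬ R u v) (h2 : ¬ R v u) : arcs R A < A.card.choose 2 := by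
  have hv' : v ∈ A.erase u := mem_erase.2 ⟨huv.symm, hv⟩
  have c1 := card_erase_add_one hu
  have c2 := card_erase_add_one hv'
  have hd : deg R u ((A.erase u).erase v) ≤ ((A.erase u).erase v).card :=
    deg_le_card fun w hw => h w (mem_of_mem_erase (mem_of_mem_erase hw)) u hu
  have h3 := (h.mono (erase_subset u A)).arcs_le
  have h4 : ind R u u = 0 := ind_eq_zero.2 fun h' => h u hu u hu h' h'
  have h5 : deg R u (A.erase u) = deg R u ((A.erase u).erase v) := by
    conv_lhs => rw [← insert_erase hv']
    rw [deg_insert (notMem_erase _ _), ind_eq_zero.2 h1, ind_eq_zero.2 h2]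
    ring
  have h6 := arcs_erase (R := R) hu
  have h7 : A.card.choose 2 = (A.erase u).card.choose 2 + (A.erase u).card := by
    rw [← c1, choose_two_succ]
  omega

/-- A new vertex goes in front of its first out-neighbour in the list; an in-neighbour further on
would close a 3-cycle. -/
theorem exists_isTransEnum [Nonempty V] {A : Finset V} (h : Oriented R A)
    (ht : ∀ u ∈ A, ∀ v ∈ A, u ≠ v → R u v ∨ R v u)
    (hc : ∀ u ∈ A, ∀ v ∈ A, ∀ w ∈ A, R u v → R v w → ¬ R w u) : ∃ p, IsTransEnum R p A := by
  induction A using Finset.induction_on with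
  | empty =>
    exact ⟨fun _ => Classical.arbitrary V, by simp, by simp, by simp⟩
  | insert v A hv ih =>
    have hs := subset_insert v A
    obtain ⟨p, hp⟩ := ih (h.mono hs) (fun u hu w hw => ht u (hs hu) w (hs hw))
      (fun u hu w hw x hx => hc u (hs hu) w (hs hw) x (hs hx))
    have hvA := mem_insert_self v A
    have hadj : ∀ i < A.card, R (p i) v ∨ R v (p i) := fun i hi =>
      ht _ (hs (hp.mem i hi)) _ hvA fun he => hv (he ▸ hp.mem i hi)
    classical
    -- The first disjunct makes the end of the list the default position.
    by_cases hex : ∃ i, A.card ≤ i ∨ R v (p i)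
    · have ha : Nat.find hex ≤ A.card := Nat.find_min' hex (Or.inl le_rfl)
      refine ⟨_, hp.insert hv ha (fun i hi => ?_) fun i hi hiA => ?_⟩
      · have := Nat.find_min hex hi
        push Not at this
        exact (hadj i this.1).resolve_right this.2
      · rcases hi.eq_or_lt with rfl | hlt
        · exact (Nat.find_spec hex).resolve_left (by omega)
        · have h1 : R v (p (Nat.find hex)) := (Nat.find_spec hex).resolve_left (by omega)
          refine (hadj i hiA).resolve_left fun h2 => ?_
          exact hc _ hvA _ (hs (hp.mem _ (by omega))) _ (hs (hp.mem i hiA)) h1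
            (hp.adj _ _ hlt hiA) h2
    · exact (hex ⟨A.card, Or.inl le_rfl⟩).elim

/-- The number of arcs when there is a loop. -/
theorem WalkUnique.arcs_le_of_loop (h : WalkUnique R k) (hk : 3 ≤ k) {A : Finset V} {x : V}
    (hx : x ∈ A) (hxx : R x x)
    (ih : ∀ B, B ⊂ A → arcs R B ≤ B.card.choose 2 + if B.card ≤ 3 then 1 else 0) :
    arcs R A + (if 5 ≤ A.card then 1 else 0) ≤
      A.card.choose 2 + if A.card ≤ 3 then 1 else 0 := by
  classical
  have ex : Escapes R x := .of_loop hxx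
  have ex' : Escapes (_root_.flip R) x := .of_loop hxx
  have hf := h.flip
  set B := A.erase x with hB
  have hne : ∀ v ∈ B, v ≠ x := fun v hv => ne_of_mem_erase hv
  set S := B.filter fun v => R v x with hS
  set Q := B.filter fun v => R x v with hQ
  set Z := B.filter fun v => ¬ R v x ∧ ¬ R x v with hZ
  have mS : ∀ v, v ∈ S ↔ v ∈ B ∧ R v x := fun v => mem_filter
  have mQ : ∀ v, v ∈ Q ↔ v ∈ B ∧ R x v := fun v => mem_filter
  have mZ : ∀ v, v ∈ Z ↔ v ∈ B ∧ ¬ R v x ∧ ¬ R x v := fun v => mem_filter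
  -- `S` and `Q` are disjoint and independent, without arcs from `Q` to `S`: each exception gives a
  -- walk with an end at `x` that competes with one waiting on the loop.
  have dSQ : Disjoint S Q := disjoint_left.2 fun v hv hv' =>
    hne v ((mS v).1 hv).1 (h.two (by omega) ex ((mQ v).1 hv').2 ((mS v).1 hv).2 hxx hxx)
  have dNZ : Disjoint (S ∪ Q) Z := disjoint_left.2 fun v hv hv' => by
    rcases mem_union.1 hv with hv | hv
    · exact ((mZ v).1 hv').2.1 ((mS v).1 hv).2
    · exact ((mZ v).1 hv').2.2 ((mQ v).1 hv).2
  have hBu : B = S ∪ Q ∪ Z := by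
    ext v
    simp only [mem_union, mS, mQ, mZ]
    tauto
  have hSS : arcs R S = 0 := arcs_eq_zero fun u hu v hv huv =>
    hne v ((mS v).1 hv).1 (h.two (by omega) ex huv ((mS v).1 hv).2 ((mS u).1 hu).2 hxx)
  have hQQ : arcs R Q = 0 := arcs_eq_zero fun u hu v hv huv =>
    hne u ((mQ u).1 hu).1 (hf.two (by omega) ex' (show R u v from huv) ((mQ u).1 hu).2
      ((mQ v).1 hv).2 hxx)
  have hQS : ∀ r ∈ Q, ∀ s ∈ S, ¬ R r s := fun r hr s hs hrs =>
    hne r ((mQ r).1 hr).1 (h.three hk ex ((mQ r).1 hr).2 hrs ((mS s).1 hs).2 hxx hxx hxx).1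
  have hN : arcs R (S ∪ Q) ≤ S.card * Q.card := by
    rw [arcs_union dSQ, hSS, hQQ, zero_add, zero_add, mul_comm, ← smul_eq_mul, ← sum_const]
    exact sum_le_sum fun q hq => deg_le_card fun s hs _ => hQS q hq s hs
  have hdeg : deg R x B = S.card + Q.card := by
    unfold deg ind
    rw [sum_add_distrib, hS, hQ, card_filter, card_filter, add_comm]
  have hA : arcs R A = arcs R B + (S.card + Q.card) + 1 := by
    rw [arcs_erase hx, ← hB, hdeg, ind_eq_one.2 hxx]
  have cN : (S ∪ Q).card = S.card + Q.card := card_union_of_disjoint dSQ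
  have cB : B.card = S.card + Q.card + Z.card := by
    rw [hBu, card_union_of_disjoint dNZ, cN]
  have cA : A.card = B.card + 1 := (card_erase_add_one hx).symm
  have ihB := ih B (erase_ssubset hx)
  rw [hA, cA, choose_two_succ]
  have hC : ∀ n, 2 ≤ n → n - 1 ≤ n.choose 2 := fun n hn => by
    induction n, hn using Nat.le_induction with
    | base => simp
    | succ n hn ih => rw [choose_two_succ]; omega
  have hC3 : ∀ n, 3 ≤ n → 3 ≤ n.choose 2 := fun n hn => Nat.choose_le_choose 2 hn
  -- Two vertices not joined to `x` make up for the loop, and the bound for `B` suffices. With fewer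
  -- of them, the missing arcs inside `S` and inside `Q` have to be counted.
  have hz : Z.card = 0 ∨ Z.card = 1 ∨ 2 ≤ Z.card := by omega
  rcases hz with hz | hz | hz
  · have hZe : Z = ∅ := card_eq_zero.1 hz
    have : B = S ∪ Q := by rw [hBu, hZe, union_empty]
    rw [this, cN, choose_two_add] at *
    have hS2 := hC S.card
    have hQ2 := hC Q.card
    have hS3 := hC3 S.card
    have hQ3 := hC3 Q.card
    split_ifs <;> omega
  · obtain ⟨u, hu⟩ := card_eq_one.1 hz
    have huZ : u ∈ Z := by rw [hu]; exact mem_singleton_self u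
    have huN : u ∉ S ∪ Q := fun h' => disjoint_left.1 dNZ h' huZ
    have huB : u ∈ B := ((mZ u).1 huZ).1
    have hBi : B = insert u (S ∪ Q) := by rw [hBu, hu]; ext; simp
    have hBa : arcs R B = arcs R (S ∪ Q) + deg R u (S ∪ Q) + ind R u u := by
      rw [hBi, arcs_insert huN]
    have hnS : ∀ s ∈ S, R s u → ¬ R u s := fun s hs h1 h2 =>
      hne u huB (h.three hk ex h1 h2 ((mS s).1 hs).2 ((mS s).1 hs).2 hxx hxx).1
    have hnQ : ∀ r ∈ Q, R r u → ¬ R u r := fun r hr h1 h2 =>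
      hne u huB (hf.three hk ex' h2 h1 ((mQ r).1 hr).2 ((mQ r).1 hr).2 hxx hxx).1
    have dS : deg R u S ≤ S.card := deg_le_card hnS
    have dQ : deg R u Q ≤ Q.card := deg_le_card hnQ
    have dN : deg R u (S ∪ Q) = deg R u S + deg R u Q := deg_union dSQ
    rw [cB, hz, choose_two_succ, choose_two_add]
    have hS2 := hC S.card
    have hQ2 := hC Q.card
    have hS3 := hC3 S.card
    have hQ3 := hC3 Q.card
    by_cases hul : R u u
    · have hone : ind R u u = 1 := ind_eq_one.2 hul
      have hS' : ∀ s ∈ S, ¬ R u s := fun s hs h1 => by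
        have := (h.three hk ex hul h1 ((mS s).1 hs).2 h1 ((mS s).1 hs).2 hxx).1
        exact huN (mem_union_left _ (by rwa [this]))
      have hQ' : ∀ r ∈ Q, ¬ R r u := fun r hr h1 => by
        have := (hf.three hk ex' hul h1 ((mQ r).1 hr).2 h1 ((mQ r).1 hr).2 hxx).1
        exact huN (mem_union_right _ (by rwa [this]))
      -- Otherwise one can pass from some `s` to some `r` waiting either at `u` or at `x`.
      have hor : deg R u S = 0 ∨ deg R u Q = 0 := by
        by_contra! hcon
        obtain ⟨s, hs, hs'⟩ : ∃ s ∈ S, R s u := by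
          by_contra! hno
          exact hcon.1 (sum_eq_zero fun s hs => by
            rw [ind_eq_zero.2 (hno s hs), ind_eq_zero.2 (hS' s hs), add_zero])
        obtain ⟨r, hr, hr'⟩ : ∃ r ∈ Q, R u r := by
          by_contra! hno
          exact hcon.2 (sum_eq_zero fun r hr => by
            rw [ind_eq_zero.2 (hno r hr), ind_eq_zero.2 (hQ' r hr), add_zero])
        have hwalk : ∀ y, R s y → R y y → R y r → ∀ i < k,
            R ((fun t => if t = 0 then s else if t < k then y else r) i)
              ((fun t => if t = 0 then s else if t < k then y else r) (i + 1)) := by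
          intro y h1 h2 h3 i hi
          rcases Nat.eq_zero_or_pos i with rfl | hi0
          · simpa [show 1 < k by omega] using h1
          · by_cases hik : i + 1 < k
            · simpa [hi0.ne', hi, hik] using h2
            · simpa [hi0.ne', hi, hik] using h3
        have := h _ _ (hwalk u hs' hul hr') (hwalk x ((mS s).1 hs).2 hxx ((mQ r).1 hr).2) rfl
          (by simp [show k ≠ 0 by omega]) 1 (by omega)
        exact hne u huB (by simpa [show 1 < k by omega] using this)
      split_ifs <;> omega
    · have hzero : ind R u u = 0 := ind_eq_zero.2 hul
      split_ifs <;> omega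
  · split_ifs at * <;> omega

/-- The number of arcs when there is a pair of opposite arcs, but no loop. -/
theorem WalkUnique.arcs_le_of_two (h : WalkUnique R k) (hk : 4 ≤ k) {A : Finset V} {x y : V}
    (hx : x ∈ A) (hy : y ∈ A) (hne : x ≠ y) (hxy : R x y) (hyx : R y x)
    (hl : ∀ v ∈ A, ¬ R v v)
    (ih : ∀ B, B ⊂ A → arcs R B ≤ B.card.choose 2 + if B.card ≤ 3 then 1 else 0) :
    arcs R A + (if 5 ≤ A.card then 1 else 0) ≤
      A.card.choose 2 + if A.card ≤ 3 then 1 else 0 := by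
  classical
  have ex : Escapes R x := .of_two hxy hyx
  have ey : Escapes R y := .of_two hyx hxy
  have hyA : y ∈ A.erase x := mem_erase.2 ⟨hne.symm, hy⟩
  set B := (A.erase x).erase y with hB
  have hBx : ∀ v ∈ B, v ≠ x := fun v hv => ne_of_mem_erase (mem_of_mem_erase hv)
  have hBy : ∀ v ∈ B, v ≠ y := fun v hv => ne_of_mem_erase hv
  have hBA : B ⊆ A := (erase_subset _ _).trans (erase_subset _ _)
  have hAu : A = B ∪ {x, y} := by
    ext v
    simp only [hB, mem_union, mem_erase, mem_insert, mem_singleton]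
    constructor
    · tauto
    · rintro (h | rfl | rfl)
      · exact h.2.2
      · exact hx
      · exact hy
  have dB : Disjoint {x, y} B := by
    rw [disjoint_left]
    rintro v hv hvB
    rcases mem_insert.1 hv with rfl | hv
    · exact hBx _ hvB rfl
    · exact hBy _ hvB (mem_singleton.1 hv)
  have hdef : ∀ v, deg R v {x, y} = ind R v x + ind R x v + (ind R v y + ind R y v) :=
    fun v => sum_pair hne
  have hA : arcs R A = 2 + arcs R B + ∑ v ∈ B, deg R v {x, y} := by
    rw [hAu, union_comm, arcs_union dB]
    congr 2
    have h1 : arcs R {x, y} = ind R x x + ind R x y + (ind R y x + ind R y y) := by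
      unfold arcs
      rw [sum_pair hne, sum_pair hne, sum_pair hne]
    rw [h1, ind_eq_one.2 hxy, ind_eq_one.2 hyx, ind_eq_zero.2 (hl x hx), ind_eq_zero.2 (hl y hy)]
  have cA : A.card = B.card + 2 := by
    rw [← card_erase_add_one hx, ← card_erase_add_one hyA]
  -- A vertex outside is joined with the 2-cycle in one direction only.
  have m1 : ∀ R' : V → V → Prop, WalkUnique R' k → ∀ x y v, R' x y → R' y x → v ≠ x → v ≠ y →
      (R' v x ∨ R' v y) → (R' x v ∨ R' y v) → False := by
    intro R' h' x y v hxy hyx hvx hvy h1 h2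
    have ex : Escapes R' x := .of_two hxy hyx
    have ey : Escapes R' y := .of_two hyx hxy
    rcases h1 with h1 | h1 <;> rcases h2 with h2 | h2
    · exact hvy (h'.two (by omega) ex h2 h1 hxy hyx)
    -- The walks `y, v, x, y, x` and `y, x, y, v, x`. The next case is the same with `x` and `y`
    -- exchanged.
    · exact hvx (h'.four hk ex h2 h1 hxy hyx hyx hxy h2 h1)
    · exact hvy (h'.four hk ey h2 h1 hyx hxy hxy hyx h2 h1)
    · exact hvx (h'.two (by omega) ey h2 h1 hyx hxy)
  have mixed : ∀ v ∈ B, (R v x ∨ R v y) → (R x v ∨ R y v) → False := fun v hv =>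
    m1 R h x y v hxy hyx (hBx v hv) (hBy v hv)
  have hd2 : ∀ v ∈ B, deg R v {x, y} ≤ 2 := by
    intro v hv
    have := mixed v hv
    rw [hdef]
    by_cases h1 : R v x ∨ R v y
    · have h2 : ¬ R x v := fun h2 => this h1 (Or.inl h2)
      have h3 : ¬ R y v := fun h2 => this h1 (Or.inr h2)
      rw [ind_eq_zero.2 h2, ind_eq_zero.2 h3]
      have := ind_le_one (R := R) v x
      have := ind_le_one (R := R) v y
      omega
    · push Not at h1
      rw [ind_eq_zero.2 h1.1, ind_eq_zero.2 h1.2]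
      have := ind_le_one (R := R) x v
      have := ind_le_one (R := R) y v
      omega
  have ihB := ih B ⟨hBA, fun hAB => hBx x (hAB hx) rfl⟩
  rw [hA, cA, show B.card + 2 = B.card + 1 + 1 from rfl, choose_two_succ, choose_two_succ]
  -- If `B` is oriented, the vertices with two arcs to the 2-cycle are independent, and the arcs
  -- missing among them offset their surplus. Otherwise `B` has a second 2-cycle, which is not
  -- joined to the first at all.
  by_cases hor : Oriented R B
  · set F := B.filter fun v => deg R v {x, y} = 2 with hF
    have hFB : F ⊆ B := filter_subset _ _
    have full : ∀ v ∈ F, (R v x ∧ R v y) ∨ (R x v ∧ R y v) := by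
      intro v hv
      have h1 := (mem_filter.1 hv).2
      have h2 := mixed v (hFB hv)
      rw [hdef] at h1
      by_contra hcon
      have e1 := ind_le_one (R := R) v x
      have e2 := ind_le_one (R := R) v y
      have e3 := ind_le_one (R := R) x v
      have e4 := ind_le_one (R := R) y v
      by_cases g : R v x ∨ R v y
      · have g1 : ¬ R x v := fun h' => h2 g (Or.inl h')
        have g2 : ¬ R y v := fun h' => h2 g (Or.inr h')
        rw [ind_eq_zero.2 g1, ind_eq_zero.2 g2] at h1
        exact hcon (Or.inl ⟨ind_eq_one.1 (by omega), ind_eq_one.1 (by omega)⟩)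
      · push Not at g
        rw [ind_eq_zero.2 g.1, ind_eq_zero.2 g.2] at h1
        exact hcon (Or.inr ⟨ind_eq_one.1 (by omega), ind_eq_one.1 (by omega)⟩)
    have indep : ∀ v ∈ F, ∀ w ∈ F, ¬ R v w := by
      intro v hv w hw hvw
      rcases full v hv with ⟨v1, v2⟩ | ⟨v1, v2⟩ <;> rcases full w hw with ⟨w1, w2⟩ | ⟨w1, w2⟩
      · exact hBy w (hFB hw) (h.two (by omega) ex hvw w1 v2 hyx)
      -- If `v` precedes the 2-cycle and `w` follows it, the arc from `v` to `w` is not even needed: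
      -- a walk of length `k` from `v` to `w` may enter the cycle at `x` or at `y`.
      · have hwalk : ∀ a b, R v a → R a b → R b a → R a w → R b w → ∀ i < k,
            R ((fun t => if t = 0 then v else if t < k then (if t % 2 = 1 then a else b) else w) i)
              ((fun t => if t = 0 then v else if t < k then (if t % 2 = 1 then a else b)
                else w) (i + 1)) := by
          intro a b h1 h2 h3 h4 h5 i hi
          rcases Nat.eq_zero_or_pos i with rfl | hi0
          · simpa [show 1 < k by omega] using h1
          · rcases Nat.mod_two_eq_zero_or_one i with hm | hm
            · have hm' : (i + 1) % 2 = 1 := by omega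
              by_cases hik : i + 1 < k
              · simpa [hi0.ne', hi, hik, hm, hm'] using h3
              · simpa [hi0.ne', hi, hik, hm] using h5
            · have hm' : (i + 1) % 2 = 0 := by omega
              by_cases hik : i + 1 < k
              · simpa [hi0.ne', hi, hik, hm, hm'] using h2
              · simpa [hi0.ne', hi, hik, hm] using h4
        have := h _ _ (hwalk x y v1 hxy hyx w1 w2) (hwalk y x v2 hyx hxy w2 w1) rfl
          (by simp [show k ≠ 0 by omega]) 1 (by omega)
        exact hne (by simpa [show 1 < k by omega] using this)
      · exact hBy v (hFB hv) (h.three (by omega) ey v1 hvw w2 hxy hyx hxy).1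
      · exact hBy v (hFB hv) (h.flip.two (by omega) (Escapes.of_two hyx hxy)
          (show R v w from hvw) v1 w2 hxy)
    have hFa : arcs R F = 0 := arcs_eq_zero indep
    have hBu : B = F ∪ (B \ F) := (union_sdiff_of_subset hFB).symm
    have cB : F.card + (B \ F).card = B.card := by
      rw [add_comm]; exact card_sdiff_add_card_eq_card hFB
    have hBa : arcs R B ≤ (B \ F).card.choose 2 + (B \ F).card * F.card := by
      conv_lhs => rw [hBu]
      rw [arcs_union disjoint_sdiff, hFa, zero_add]
      refine add_le_add (hor.mono sdiff_subset).arcs_le ?_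
      rw [← smul_eq_mul, ← sum_const]
      exact sum_le_sum fun v hv => deg_le_card fun u hu =>
        hor u (hFB hu) v (mem_sdiff.1 hv).1
    have hs : ∑ v ∈ B, deg R v {x, y} ≤ 2 * F.card + (B \ F).card := by
      conv_lhs => rw [hBu]
      rw [sum_union disjoint_sdiff, mul_comm, ← smul_eq_mul, ← sum_const, card_eq_sum_ones (B \ F)]
      refine add_le_add (sum_le_sum fun v hv => hd2 v (hFB hv)) (sum_le_sum fun v hv => ?_)
      have h1 := hd2 v (mem_sdiff.1 hv).1
      have h2 : deg R v {x, y} ≠ 2 := fun h2 =>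
        (mem_sdiff.1 hv).2 (mem_filter.2 ⟨(mem_sdiff.1 hv).1, h2⟩)
      omega
    rw [← cB, choose_two_add]
    rw [mul_comm] at hBa
    have hC : 2 ≤ F.card → F.card - 1 ≤ F.card.choose 2 := by
      intro hn
      generalize F.card = n at hn
      induction n, hn using Nat.le_induction with
      | base => simp
      | succ n hn ih => rw [choose_two_succ]; omega
    generalize F.card * (B \ F).card = fg at *
    split_ifs <;> omega
  · unfold Oriented at hor
    push Not at hor
    obtain ⟨v, hv, w, hw, hvw, hwv⟩ := hor
    have hvne : v ≠ w := fun he => hl v (hBA hv) (by rwa [← he] at hvw)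
    have key : ∀ R' : V → V → Prop, WalkUnique R' k → ∀ x y, R' x y → R' y x → ∀ v w,
        R' v w → R' w v → w ≠ x → w ≠ y → ¬ R' v x ∧ ¬ R' v y := by
      intro R' h' x y hxy hyx v w hvw hwv hwx hwy
      exact ⟨fun hvx => hwx (h'.three (by omega) (.of_two hxy hyx) hvw hwv hvx hvx hxy hyx).1,
        fun hvy => hwy (h'.three (by omega) (.of_two hyx hxy) hvw hwv hvy hvy hyx hxy).1⟩
    have hzero : ∀ v ∈ B, ∀ w ∈ B, R v w → R w v → deg R v {x, y} = 0 := by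
      intro v hv w hw hvw hwv
      have k1 := key R h x y hxy hyx v w hvw hwv (hBx w hw) (hBy w hw)
      have k2 : ¬ R x v ∧ ¬ R y v := key _ h.flip x y hyx hxy v w hwv hvw (hBx w hw) (hBy w hw)
      rw [hdef, ind_eq_zero.2 k1.1, ind_eq_zero.2 k1.2, ind_eq_zero.2 k2.1, ind_eq_zero.2 k2.2]
    have hw' : w ∈ B.erase v := mem_erase.2 ⟨hvne.symm, hw⟩
    have c1 := card_erase_add_one hv
    have c2 := card_erase_add_one hw'
    have hs : ∑ v ∈ B, deg R v {x, y} ≤ 2 * ((B.erase v).erase w).card := by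
      rw [← add_sum_erase B _ hv, ← add_sum_erase _ _ hw', hzero v hv w hw hvw hwv,
        hzero w hw v hv hwv hvw, zero_add, zero_add, mul_comm, ← smul_eq_mul, ← sum_const]
      exact sum_le_sum fun u hu => hd2 u (mem_of_mem_erase (mem_of_mem_erase hu))
    split_ifs at * <;> omega

/-- A tournament with a 3-cycle has at most four vertices. -/
theorem WalkUnique.arcs_lt_of_three (h : WalkUnique R k) (hk : 4 ≤ k) {A : Finset V}
    (hor : Oriented R A) {x y z : V} (hx : x ∈ A) (hy : y ∈ A) (hz : z ∈ A) (hxy : R x y)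
    (hyz : R y z) (hzx : R z x) (hA : 5 ≤ A.card) : arcs R A < A.card.choose 2 := by
  by_contra hcon
  have ht : ∀ u ∈ A, ∀ v ∈ A, u ≠ v → R u v ∨ R v u := by
    intro u hu v hv huv
    by_contra! hno
    exact hcon (hor.arcs_lt hu hv huv hno.1 hno.2)
  have hirr : ∀ u ∈ A, ¬ R u u := fun u hu h' => hor u hu u hu h' h'
  have ex : Escapes R x := .of_three hxy hyz hzx
  have ey : Escapes R y := .of_three hyz hzx hxy
  have ez : Escapes R z := .of_three hzx hxy hyz
  -- no vertex has an in- and an out-neighbour on the 3-cycle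
  have mixed : ∀ x y z v, R x y → R y z → R z x → v ≠ z → R y v → R v x → False := by
    intro x y z v hxy hyz hzx hvz hyv hvx
    exact hvz (h.three (by omega) (.of_three hxy hyz hzx) hxy hyv hvx hxy hyz hzx).2
  obtain ⟨v, hv, w, hw, hvw⟩ : ∃ v ∈ ((A.erase x).erase y).erase z,
      ∃ w ∈ ((A.erase x).erase y).erase z, v ≠ w := by
    apply one_lt_card.1
    have h1 := pred_card_le_card_erase (s := A) (a := x)
    have h2 := pred_card_le_card_erase (s := A.erase x) (a := y)
    have h3 := pred_card_le_card_erase (s := (A.erase x).erase y) (a := z)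
    omega
  simp only [mem_erase] at hv hw
  have full : ∀ v, v ≠ z ∧ v ≠ y ∧ v ≠ x ∧ v ∈ A →
      (R v x ∧ R v y ∧ R v z) ∨ (R x v ∧ R y v ∧ R z v) := by
    rintro v ⟨vz, vy, vx, vA⟩
    have m1 := mixed x y z v hxy hyz hzx vz
    have m2 := mixed y z x v hyz hzx hxy vx
    have m3 := mixed z x y v hzx hxy hyz vy
    have t1 := ht v vA x hx vx
    have t2 := ht v vA y hy vy
    have t3 := ht v vA z hz vz
    tauto
  -- Every further vertex dominates the 3-cycle or is dominated by it. An arc between two of them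
  -- that creates competing short walks is excluded; if `v` precedes the cycle and `w` follows it,
  -- walks may enter the cycle at `x` or at `y`. So no two further vertices are adjacent.
  have hns : ∀ v w, (v ≠ z ∧ v ≠ y ∧ v ≠ x ∧ v ∈ A) → (w ≠ z ∧ w ≠ y ∧ w ≠ x ∧ w ∈ A) →
      R v w → False := by
    intro v w hv hw hvw
    rcases full v hv with ⟨v1, v2, v3⟩ | ⟨v1, v2, v3⟩ <;>
      rcases full w hw with ⟨w1, w2, w3⟩ | ⟨w1, w2, w3⟩
    · exact hw.1 (h.two (by omega) ex hvw w1 v3 hzx)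
    · have hwalk : ∀ a b c, R v a → R a b → R b c → R c a → R a w → R b w → R c w → ∀ i < k,
          R ((fun t => if t = 0 then v else if t < k then
              (if t % 3 = 1 then a else if t % 3 = 2 then b else c) else w) i)
            ((fun t => if t = 0 then v else if t < k then
              (if t % 3 = 1 then a else if t % 3 = 2 then b else c) else w) (i + 1)) := by
        intro a b c h1 h2 h3 h4 h5 h6 h7 i hi
        rcases Nat.eq_zero_or_pos i with rfl | hi0
        · simpa [show 1 < k by omega] using h1
        · rcases (show i % 3 = 0 ∨ i % 3 = 1 ∨ i % 3 = 2 by omega) with hm | hm | hm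
          · have hm' : (i + 1) % 3 = 1 := by omega
            by_cases hik : i + 1 < k
            · simpa [hi0.ne', hi, hik, hm, hm'] using h4
            · simpa [hi0.ne', hi, hik, hm] using h7
          · have hm' : (i + 1) % 3 = 2 := by omega
            by_cases hik : i + 1 < k
            · simpa [hi0.ne', hi, hik, hm, hm'] using h2
            · simpa [hi0.ne', hi, hik, hm] using h5
          · have hm' : (i + 1) % 3 = 0 := by omega
            by_cases hik : i + 1 < k
            · simpa [hi0.ne', hi, hik, hm, hm'] using h3
            · simpa [hi0.ne', hi, hik, hm] using h6
      have := h _ _ (hwalk x y z v1 hxy hyz hzx w1 w2 w3) (hwalk y z x v2 hyz hzx hxy w2 w3 w1)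
        rfl (by simp [show k ≠ 0 by omega]) 1 (by omega)
      have hxy' : x = y := by simpa [show 1 < k by omega] using this
      exact hirr x hx (by rwa [← hxy'] at hxy)
    · exact hv.2.1 (h.three (by omega) ex v1 hvw w1 hxy hyz hzx).1
    · exact hv.2.1 (h.flip.two (by omega) (Escapes.of_three hzx hyz hxy)
        (show R v w from hvw) v1 w2 hxy)
  rcases ht v hv.2.2.2 w hw.2.2.2 hvw with h1 | h1
  · exact hns v w hv hw h1
  · exact hns w v hw hv h1

/-- The extra arc for at most three vertices is needed: a single loop or a 2-cycle exceeds the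
binomial coefficient. From five vertices on, a loop or a 2-cycle makes the bound strict, so equality
leaves a tournament, and 3-cycles are excluded too. -/
theorem WalkUnique.arcs_bound (h : WalkUnique R k) (hk : 4 ≤ k) (A : Finset V) :
    arcs R A ≤ A.card.choose 2 + (if A.card ≤ 3 then 1 else 0) ∧
      (5 ≤ A.card → arcs R A = A.card.choose 2 →
        Oriented R A ∧ ∃ p, IsTransEnum R p A) := by
  induction A using Finset.strongInduction with
  | H A ih =>
    have ih' : ∀ B, B ⊂ A → arcs R B ≤ B.card.choose 2 + if B.card ≤ 3 then 1 else 0 :=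
      fun B hB => (ih B hB).1
    have aux : arcs R A + (if 5 ≤ A.card then 1 else 0) ≤
        A.card.choose 2 + (if A.card ≤ 3 then 1 else 0) →
        arcs R A ≤ A.card.choose 2 + (if A.card ≤ 3 then 1 else 0) ∧
          (5 ≤ A.card → arcs R A = A.card.choose 2 →
        Oriented R A ∧ ∃ p, IsTransEnum R p A) := by
      intro h1
      refine ⟨by omega, fun h5 he => ?_⟩
      split_ifs at h1 <;> omega
    by_cases hloop : ∃ x ∈ A, R x x
    · obtain ⟨x, hx, hxx⟩ := hloop
      exact aux (h.arcs_le_of_loop (by omega) hx hxx ih')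
    push Not at hloop
    by_cases hor : Oriented R A
    · have hle := hor.arcs_le
      refine ⟨by omega, fun h5 he => ?_⟩
      have : Nonempty V := ⟨(card_pos.1 (by omega : 0 < A.card)).choose⟩
      refine ⟨hor, exists_isTransEnum hor (fun u hu v hv huv => ?_)
        fun u hu v hv w hw huv hvw hwu => ?_⟩
      · by_contra! hno
        exact (hor.arcs_lt hu hv huv hno.1 hno.2).ne he
      · exact (h.arcs_lt_of_three hk hor hu hv hw huv hvw hwu h5).ne he
    · unfold Oriented at hor
      push Not at hor
      obtain ⟨x, hx, y, hy, hxy, hyx⟩ := hor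
      exact aux (h.arcs_le_of_two hk hx hy (fun he => hloop x hx (by rwa [← he] at hxy))
        hxy hyx hloop ih')

end Small

/-! ### The size of completely transitive tournaments -/

section Numbers

/-- The size of the completely transitive tournaments of order `n` with `k` levels. -/
def turanSize (k : ℕ) : ℕ → ℕ
  | 0 => 0
  | n + 1 => turanSize k n + (n - n / k)

theorem two_mul_choose_two (n : ℕ) : 2 * n.choose 2 + n = n ^ 2 := by
  induction n with
  | zero => rfl
  | succ n ih => rw [choose_two_succ]; nlinarith

/-- The terms next to `2 * turanSize k m` are the sum of the squares of the level sizes: `m % k`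
levels have `m / k + 1` vertices, the others `m / k`. -/
theorem two_mul_turanSize {k : ℕ} (hk : 0 < k) (m : ℕ) :
    2 * turanSize k m + m / k * m + m % k * (1 + m / k) = m ^ 2 := by
  induction m with
  | zero => simp [turanSize]
  | succ m ih =>
    have hm := Nat.div_add_mod m k
    have hlt := Nat.mod_lt m hk
    have hle : m / k ≤ m := Nat.div_le_self m k
    obtain ⟨d, hd⟩ : ∃ d, m = m / k + d := ⟨m - m / k, by omega⟩
    have hd' : m - m / k = d := by omega
    rw [turanSize, hd']
    generalize m / k = s at *
    generalize m % k = t at *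
    rcases Nat.lt_or_ge (t + 1) k with h | h
    · have h1 : (m + 1) / k = s := by
        rw [← hm, add_assoc, Nat.mul_add_div hk, Nat.div_eq_of_lt h, add_zero]
      have h2 : (m + 1) % k = t + 1 := by
        rw [← hm, add_assoc, Nat.mul_add_mod, Nat.mod_eq_of_lt h]
      rw [h1, h2]
      nlinarith
    · have ht : t + 1 = k := by omega
      have h0 : m + 1 = k * (s + 1) := by rw [← hm, mul_add, mul_one]; omega
      have h1 : (m + 1) / k = s + 1 := by rw [h0, Nat.mul_div_cancel_left _ hk]
      have h2 : (m + 1) % k = 0 := by rw [h0, Nat.mul_mod_right]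
      rw [h1, h2]
      nlinarith

/-- For these orders `j` levels have two vertices, and each of them lacks one arc. -/
theorem turanSize_add {k : ℕ} (j : ℕ) (hj : j ≤ k) :
    turanSize k (k + j) + j = (k + j).choose 2 := by
  induction j with
  | zero =>
    have : ∀ n ≤ k, turanSize k n = n.choose 2 := by
      intro n hn
      induction n with
      | zero => rfl
      | succ n ih =>
        rw [turanSize, choose_two_succ, ih (by omega), Nat.div_eq_of_lt (by omega), Nat.sub_zero]
    simpa using this k le_rfl
  | succ j ih =>
    have hd : (k + j) / k = 1 := by
      rw [Nat.add_div_left _ (by omega), Nat.div_eq_of_lt (by omega)]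
    have := ih (by omega)
    change turanSize k (k + j + 1) + (j + 1) = (k + j + 1).choose 2
    rw [turanSize, choose_two_succ, hd]
    omega

theorem turanSize_eq {n s k t : ℕ} (hn : n = s * k + t) (ht : t < k) :
    (turanSize k n : ℤ) = (n.choose 2 : ℤ) - (s.choose 2 : ℤ) * k - s * t := by
  have hk : 0 < k := by omega
  have h1 : n / k = s := by
    rw [hn, mul_comm, Nat.mul_add_div hk, Nat.div_eq_of_lt ht, add_zero]
  have h2 : n % k = t := by rw [hn, mul_comm, Nat.mul_add_mod, Nat.mod_eq_of_lt ht]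
  have h3 := two_mul_turanSize hk n
  have h4 := two_mul_choose_two n
  have h5 := two_mul_choose_two s
  rw [h1, h2] at h3
  zify at h3 h4 h5 hn
  have h6 : (k : ℤ) * (2 * (s.choose 2 : ℤ) + s) = k * (s : ℤ) ^ 2 := by rw [h5]
  have h7 : (s : ℤ) * n = s * (s * k + t) := by rw [← hn]
  linarith

end Numbers

/-! ### The upper bound -/

section Upper

variable {V : Type*} {R : V → V → Prop} {k : ℕ}

theorem IsTransEnum.deg_eq {p : ℕ → V} {K : Finset V} (hp : IsTransEnum R p K) (v : V) :
    deg R v K = ∑ i ∈ range K.card, (ind R v (p i) + ind R (p i) v) := hp.sum _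

theorem IsTransEnum.ne {p : ℕ → V} {K : Finset V} (hp : IsTransEnum R p K) {v : V} (hv : v ∉ K)
    {i : ℕ} (hi : i < K.card) : p i ≠ v := fun he => hv (he ▸ hp.mem i hi)

/-- No vertex outside a transitive tournament of order `k + 1` has an arc to the first vertex. -/
theorem IsTransEnum.not_adj_first {p : ℕ → V} {K : Finset V} (hp : IsTransEnum R p K)
    (h : WalkUnique R k) (hk : 4 ≤ k) (hK : K.card = k + 1) (v : V) : ¬ R v (p 0) := by
  intro hv
  -- On the walk `v, p 0, …, p k` both `p 1` and `p 2` can be skipped.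
  have := h.skip (f := fun t => if t = 0 then v else p (t - 1)) (fun i hi => by
    rcases Nat.eq_zero_or_pos i with rfl | hi0
    · simpa using hv
    · simpa [hi0.ne'] using hp.adj (i - 1) i (by omega) (by omega)) (a := 2) (b := 3)
    (by norm_num) (by norm_num) (by omega) (by simpa using hp.adj 0 2 (by omega) (by omega))
    (by simpa using hp.adj 1 3 (by omega) (by omega))
  have := hp.inj (by omega) (by omega) (by simpa using this : p 1 = p 2)
  omega

/-- A loop outside a transitive tournament is joined to at most two of its vertices. -/
theorem IsTransEnum.deg_le_of_loop {p : ℕ → V} {K : Finset V} (hp : IsTransEnum R p K)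
    (h : WalkUnique R k) (hk : 2 ≤ k) {v : V} (hv : v ∉ K) (hvv : R v v) : deg R v K ≤ 2 := by
  classical
  have key : ∀ (R' : V → V → Prop) (p' : ℕ → V), IsTransEnum R' p' K → WalkUnique R' k → R' v v →
      ∑ u ∈ K, ind R' u v ≤ 1 := by
    intro R' p' hp' h' hv'
    unfold ind
    rw [← card_filter]
    by_contra! hcon
    obtain ⟨a, ha, b, hb, hab⟩ := one_lt_card.1 hcon
    simp only [mem_filter] at ha hb
    obtain ⟨i, hi, rfl⟩ := hp'.surj a ha.1
    obtain ⟨j, hj, rfl⟩ := hp'.surj b hb.1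
    rcases lt_trichotomy i j with hij | rfl | hij
    · exact hp'.ne hv hj (h'.two hk (.of_loop hv') (hp'.adj i j hij hj) hb.2 ha.2 hv')
    · exact hab rfl
    · exact hp'.ne hv hi (h'.two hk (.of_loop hv') (hp'.adj j i hij hi) ha.2 hb.2 hv')
  have h1 := key R p hp h hvv
  have h2 := key _ _ hp.flip h.flip hvv
  unfold deg
  rw [sum_add_distrib]
  simp only [ind_flip] at h2
  omega

/-- The arc would give `v, w, p 2, …, p k` beside `v, p 1, p 2, …, p k`. -/
theorem IsTransEnum.not_adj_of_first {p : ℕ → V} {K : Finset V} (hp : IsTransEnum R p K)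
    (h : WalkUnique R k) (hk : 4 ≤ k) (hK : K.card = k + 1) {v w : V} (hw : w ∉ K)
    (hv' : ∀ i, 1 ≤ i → i ≤ k → R v (p i)) (hw' : ∀ i, 1 ≤ i → i ≤ k → R w (p i)) :
    ¬ R v w := by
  intro hvw
  have := h (fun t => if t = 0 then v else if t = 1 then w else p t)
    (fun t => if t = 0 then v else p t) (fun t ht => by
      rcases (show t = 0 ∨ t = 1 ∨ 2 ≤ t by omega) with rfl | rfl | c
      · simpa using hvw
      · simpa using hw' 2 (by omega) (by omega)
      · simpa [show t ≠ 0 by omega, show t ≠ 1 by omega] using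
          hp.adj t (t + 1) (by omega) (by omega))
    (fun t ht => by
      rcases Nat.eq_zero_or_pos t with rfl | c
      · simpa using hv' 1 (by omega) (by omega)
      · simpa [c.ne'] using hp.adj t (t + 1) (by omega) (by omega)) rfl
    (by simp [show k ≠ 0 by omega, show k ≠ 1 by omega]) 1 (by omega)
  exact hp.ne hw (i := 1) (by omega) (by simpa using this.symm)

/-- The 2-cycle would give `v, w, v, p 3, …, p k` beside `v, p 1, p 2, p 3, …, p k`. -/
theorem IsTransEnum.not_two_cycle_of_first {p : ℕ → V} {K : Finset V} (hp : IsTransEnum R p K)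
    (h : WalkUnique R k) (hk : 4 ≤ k) (hK : K.card = k + 1) {v w : V} (hw : w ∉ K)
    (hv' : ∀ i, 1 ≤ i → i ≤ k → R v (p i)) (hvw : R v w) : ¬ R w v := by
  intro hwv
  have := h (fun t => if t = 0 then v else if t = 1 then w else if t = 2 then v else p t)
    (fun t => if t = 0 then v else p t) (fun t ht => by
      rcases (show t = 0 ∨ t = 1 ∨ t = 2 ∨ 3 ≤ t by omega) with rfl | rfl | rfl | c
      · simpa using hvw
      · simpa using hwv
      · simpa using hv' 3 (by omega) (by omega)
      · simpa [show t ≠ 0 by omega, show t ≠ 1 by omega, show t ≠ 2 by omega] using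
          hp.adj t (t + 1) (by omega) (by omega))
    (fun t ht => by
      rcases Nat.eq_zero_or_pos t with rfl | c
      · simpa using hv' 1 (by omega) (by omega)
      · simpa [c.ne'] using hp.adj t (t + 1) (by omega) (by omega)) rfl
    (by simp [show k ≠ 0 by omega, show k ≠ 1 by omega, show k ≠ 2 by omega]) 1 (by omega)
  exact hp.ne hw (i := 1) (by omega) (by simpa using this.symm)

/-- A vertex outside a transitive tournament of order `k + 1` leaves a gap between its in- and its
out-neighbours. -/
theorem IsTransEnum.gap {p : ℕ → V} {K : Finset V} (hp : IsTransEnum R p K)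
    (h : WalkUnique R k) (hk : 4 ≤ k) (hK : K.card = k + 1) {v : V} (hv : v ∉ K) {i j : ℕ}
    (hi : i ≤ k) (hj : j ≤ k) (h1 : R (p i) v) (h2 : R v (p j)) : i + 3 ≤ j := by
  by_contra hij
  -- The detour `p i, v, p j` takes the places `s, s + 1, s + 2` of `p 0, …, p k`. It fits in if `s
  -- ≤ i` and `j ≤ s + 2`; to keep the ends, `s = 0` requires `i = 0` and `s + 2 = k` requires `j =
  -- k`.
  obtain ⟨s, hs0, hs1, hsi, hsj, hsk⟩ : ∃ s, (i = 0 → s = 0) ∧ (i ≠ 0 → 1 ≤ s) ∧ s ≤ i ∧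
      j ≤ s + 2 ∧ (s + 2 = k ∧ j = k ∨ s + 3 ≤ k) := by
    by_cases h0 : i = 0
    · exact ⟨0, by omega⟩
    · by_cases h3 : j = k
      · exact ⟨k - 2, by omega⟩
      · exact ⟨max 1 (j - 2), by omega⟩
  have := h (fun t => if t < s then p t else if t = s then p i else if t = s + 1 then v else
      if t = s + 2 then p j else p t) p (fun t ht => by
    rcases lt_or_ge (t + 1) s with c | c
    · simpa [c, show t < s by omega] using hp.adj t (t + 1) (by omega) (by omega)
    rcases c.eq_or_lt with c | c
    · subst c
      simpa using hp.adj t i (by omega) (by omega)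
    rcases (show t = s ∨ t = s + 1 ∨ t = s + 2 ∨ s + 3 ≤ t by omega) with rfl | rfl | rfl | c
    · simpa using h1
    · simpa [show ¬ s + 1 + 1 < s by omega, show s + 1 + 1 ≠ s by omega] using h2
    · simpa [show ¬ s + 2 + 1 < s by omega, show s + 2 + 1 ≠ s by omega] using
        hp.adj j (s + 3) (by omega) (by omega)
    · simpa [show ¬ t < s by omega, show ¬ t + 1 < s by omega, show t ≠ s by omega,
        show t + 1 ≠ s by omega, show t ≠ s + 1 by omega, show t ≠ s + 2 by omega,
        show t + 1 ≠ s + 2 by omega] using hp.adj t (t + 1) (by omega) (by omega))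
    (fun t ht => hp.adj t (t + 1) (by omega) (by omega))
    (by
      by_cases h0 : i = 0
      · simp [hs0 h0, h0]
      · have := hs1 h0
        simp [show 0 < s by omega])
    (by
      rcases hsk with ⟨rfl, rfl⟩ | c
      · simp
      · simp [show ¬ k < s by omega, show k ≠ s by omega, show k ≠ s + 1 by omega,
          show k ≠ s + 2 by omega]) (s + 1) (by omega)
  exact hp.ne hv (i := s + 1) (by omega) (by simpa using this.symm)

theorem sum_range_le_of_zero {n : ℕ} {g : ℕ → ℕ} (hg : ∀ i < n, g i ≤ 1) {a : ℕ} (ha : a < n)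
    (h0 : g a = 0) : ∑ i ∈ range n, g i + 1 ≤ n ∧
      (∑ i ∈ range n, g i + 1 = n → ∀ i < n, i ≠ a → g i = 1) := by
  have ham : a ∈ range n := mem_range.2 ha
  have hc : ((range n).erase a).card + 1 = n := by rw [card_erase_add_one ham, card_range]
  have hs : ∑ i ∈ range n, g i = ∑ i ∈ (range n).erase a, g i := by
    rw [← add_sum_erase _ _ ham, h0, zero_add]
  have hle : ∀ i ∈ (range n).erase a, g i ≤ 1 := fun i hi =>
    hg i (mem_range.1 (mem_of_mem_erase hi))
  have hle' : ∑ i ∈ (range n).erase a, g i ≤ ((range n).erase a).card := by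
    rw [card_eq_sum_ones]
    exact sum_le_sum hle
  refine ⟨by omega, fun he i hi hia => ?_⟩
  have : ∑ i ∈ (range n).erase a, g i = ∑ i ∈ (range n).erase a, 1 := by
    rw [← card_eq_sum_ones]; omega
  exact (sum_eq_sum_iff_of_le hle).1 this i (mem_erase.2 ⟨hia, mem_range.2 hi⟩)

theorem sum_range_le_of_zero_zero {n : ℕ} {g : ℕ → ℕ} (hg : ∀ i < n, g i ≤ 1) {a b : ℕ}
    (ha : a < n) (hb : b < n) (hab : a ≠ b) (h0 : g a = 0) (h1 : g b = 0) :
    ∑ i ∈ range n, g i + 2 ≤ n := by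
  have h2 := sum_range_le_of_zero hg ha h0
  by_contra hcon
  have := h2.2 (by omega) b hb hab.symm
  omega

/-- If `v` has both in- and out-neighbours in `K`, the gap behind the last in-neighbour costs two
vertices. Otherwise `v` is not joined to one end, and equality makes it a twin of that end. -/
theorem IsTransEnum.deg_le_and {p : ℕ → V} {K : Finset V} (hp : IsTransEnum R p K)
    (h : WalkUnique R k) (hk : 4 ≤ k) (hK : K.card = k + 1) {v : V} (hv : v ∉ K) :
    deg R v K ≤ k ∧ (deg R v K = k →
      (∀ i, 1 ≤ i → i ≤ k → R v (p i)) ∨ (∀ i < k, R (p i) v)) := by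
  classical
  set g : ℕ → ℕ := fun i => ind R v (p i) + ind R (p i) v with hg
  have hdeg : deg R v K = ∑ i ∈ range (k + 1), g i := by rw [hp.deg_eq, hK]
  have hnb : ∀ i < k + 1, ¬ (R (p i) v ∧ R v (p i)) := fun i hi hb => by
    have := hp.gap h hk hK hv (by omega) (by omega) hb.1 hb.2
    omega
  have hg1 : ∀ i < k + 1, g i ≤ 1 := fun i hi => by
    have := hnb i hi
    by_cases c : R (p i) v
    · simpa [hg, ind_eq_zero.2 fun c' => this ⟨c, c'⟩] using ind_le_one _ _
    · simpa [hg, ind_eq_zero.2 c] using ind_le_one _ _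
  have hfirst := hp.not_adj_first h hk hK v
  have hlast : ¬ R (p k) v := by
    have : ¬ R (p (K.card - 1 - 0)) v := hp.flip.not_adj_first h.flip hk hK v
    simpa [hK] using this
  rw [hdeg]
  by_cases hin : ∃ i ≤ k, R (p i) v
  · by_cases hout : ∃ j ≤ k, R v (p j)
    · obtain ⟨j, hj, hvj⟩ := hout
      obtain ⟨i, hi, him⟩ := exists_max_image ((range (k + 1)).filter fun i => R (p i) v) id (by
        obtain ⟨i, hi, hiv⟩ := hin
        exact ⟨i, mem_filter.2 ⟨mem_range.2 (by omega), hiv⟩⟩)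
      obtain ⟨hik, hiv⟩ := mem_filter.1 hi
      rw [mem_range] at hik
      have hij := hp.gap h hk hK hv (by omega) hj hiv hvj
      have hz : ∀ l, i < l → l < i + 3 → g l = 0 := by
        intro l hl hl'
        have e1 : ¬ R (p l) v := fun c => by
          have : l ≤ i := him l (mem_filter.2 ⟨mem_range.2 (by omega), c⟩)
          omega
        have e2 : ¬ R v (p l) := fun c => by
          have := hp.gap h hk hK hv (by omega) (by omega) hiv c
          omega
        simp [hg, ind_eq_zero.2 e1, ind_eq_zero.2 e2]
      have := sum_range_le_of_zero_zero hg1 (a := i + 1) (b := i + 2) (by omega) (by omega)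
        (by omega) (hz _ (by omega) (by omega)) (hz _ (by omega) (by omega))
      exact ⟨by omega, fun _ => by omega⟩
    · push Not at hout
      have hz : g k = 0 := by simp [hg, ind_eq_zero.2 hlast, ind_eq_zero.2 (hout k le_rfl)]
      obtain ⟨h1, h2⟩ := sum_range_le_of_zero hg1 (a := k) (by omega) hz
      refine ⟨by omega, fun he => Or.inr fun i hi => ?_⟩
      have := h2 (by omega) i (by omega) (by omega)
      simp only [hg, ind_eq_zero.2 (hout i hi.le), zero_add] at this
      exact ind_eq_one.1 this
  · push Not at hin
    have hz : g 0 = 0 := by simp [hg, ind_eq_zero.2 hfirst, ind_eq_zero.2 (hin 0 (by omega))]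
    obtain ⟨h1, h2⟩ := sum_range_le_of_zero hg1 (a := 0) (by omega) hz
    refine ⟨by omega, fun he => Or.inl fun i hi hi' => ?_⟩
    have := h2 (by omega) i (by omega) (by omega)
    simp only [hg, ind_eq_zero.2 (hin i hi'), add_zero] at this
    exact ind_eq_one.1 this

variable [DecidableEq V]

/-- By `card_mul_arcs_le` the deficits of the `n + 1` deletions add up to at most `n - 1` times that
of `A`. -/
theorem exists_erase_choose {A : Finset V} {n c : ℕ} (hA : A.card = n + 1) (hn : 1 ≤ n)
    (h : (n + 1).choose 2 ≤ arcs R A + (c + 1)) :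
    ∃ v ∈ A, n.choose 2 ≤ arcs R (A.erase v) + c := by
  by_contra! hcon
  have h1 := card_mul_arcs_le (R := R) A
  have h2 : ∑ v ∈ A, (arcs R (A.erase v) + (c + 1)) ≤ ∑ v ∈ A, n.choose 2 :=
    sum_le_sum fun v hv => by have := hcon v hv; omega
  rw [sum_add_distrib, sum_const, sum_const, smul_eq_mul, smul_eq_mul, hA] at h2
  rw [hA] at h1
  have h3 := two_mul_choose_two n
  rw [choose_two_succ] at h
  obtain ⟨m, rfl⟩ : ∃ m, n = m + 1 := ⟨n - 1, by omega⟩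
  nlinarith

/-- `e = 1` transports an excess, for the upper bound; `e = 0` transports equality, for the extremal
digraphs. -/
theorem exists_erase_turanSize {A : Finset V} {m e : ℕ} (hk : 4 ≤ k) (hA : A.card = m + 1)
    (hm : k + 4 ≤ m) (he : e ≤ 1) (h : turanSize k (m + 1) + e ≤ arcs R A) :
    ∃ v ∈ A, turanSize k m + e ≤ arcs R (A.erase v) := by
  by_contra! hcon
  have h1 := card_mul_arcs_le (R := R) A
  have h2 : ∑ v ∈ A, (arcs R (A.erase v) + 1) ≤ ∑ v ∈ A, (turanSize k m + e) :=
    sum_le_sum fun v hv => hcon v hv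
  rw [sum_add_distrib, sum_const, sum_const, smul_eq_mul, smul_eq_mul, hA] at h2
  rw [hA] at h1
  have h3 := two_mul_turanSize (show 0 < k by omega) m
  -- If every deletion fell short, averaging would give `(1 + m / k) * (1 + m % k) ≤ 2 * e`, which
  -- is at most 2.
  have h4 : 3 ≤ (1 + m / k) * (1 + m % k) := by
    have hs : 1 ≤ m / k := (Nat.one_le_div_iff (by omega)).2 (by omega)
    rcases hs.eq_or_lt with hs | hs
    · have := Nat.div_add_mod m k
      rw [← hs] at this
      have h5 : 4 ≤ m % k := by omega
      rw [← hs]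
      omega
    · calc 3 ≤ (1 + m / k) * 1 := by omega
        _ ≤ _ := Nat.mul_le_mul_left _ (by omega)
  obtain ⟨d, hd⟩ : ∃ d, m = m / k + d := ⟨m - m / k, by have := Nat.div_le_self m k; omega⟩
  have hd' : m - m / k = d := by omega
  rw [turanSize, hd'] at h
  obtain ⟨l, hl⟩ : ∃ l, m = l + 1 := ⟨m - 1, by omega⟩
  generalize m / k = s at *
  generalize m % k = t at *
  have h5 : l * (turanSize k m + d + e) ≤ l * arcs R A := Nat.mul_le_mul_left l h
  have h6 : l * arcs R A + (m + 1) ≤ (m + 1) * (turanSize k m + e) := by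
    rw [hl] at h1 h2 ⊢
    nlinarith
  generalize turanSize k m = T at *
  generalize arcs R A = a at *
  zify at *
  have hm' : (m : ℤ) = s + d := hd
  have hl' : (l : ℤ) = m - 1 := by linarith
  rw [hl'] at h5 h6
  have hdd : (d : ℤ) = m - s := by linarith
  rw [hdd] at h5
  nlinarith

/-- A transitive tournament of order `k + 2` has a Hamiltonian path of length `k + 1` on which every
inner vertex can be skipped. -/
theorem WalkUnique.arcs_lt_add_two (h : WalkUnique R k) (hk : 4 ≤ k) {A : Finset V}
    (hA : A.card = k + 2) : arcs R A + 1 ≤ (k + 2).choose 2 := by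
  obtain ⟨h1, h2⟩ := h.arcs_bound hk A
  rw [hA, if_neg (by omega)] at h1
  by_contra hcon
  obtain ⟨-, p, hp⟩ := h2 (by omega) (by rw [hA]; omega)
  have := h.skip (f := p) (fun i hi => hp.adj i (i + 1) (by omega) (by omega)) (a := 1) (b := 2)
    (by norm_num) (by norm_num) (by omega) (hp.adj 0 2 (by omega) (by omega))
    (hp.adj 1 3 (by omega) (by omega))
  have := hp.inj (by omega) (by omega) this
  omega

theorem WalkUnique.arcs_lt_add_three (h : WalkUnique R k) (hk : 4 ≤ k) {A : Finset V}
    (hA : A.card = k + 3) : arcs R A + 2 ≤ (k + 3).choose 2 := by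
  by_contra hcon
  obtain ⟨v, hv, hvA⟩ := exists_erase_choose (R := R) (n := k + 2) (c := 0) hA (by omega)
    (by have : k + 2 + 1 = k + 3 := rfl; rw [this]; omega)
  have := h.arcs_lt_add_two hk (A := A.erase v) (by have := card_erase_add_one hv; omega)
  omega

/-- With deficit at most 3, deletion of `x`, `y`, `z` leaves a transitive tournament `K` of order `k
+ 1`. The bounds at the orders between leave no slack: `x`, `y`, `z` are pairwise adjacent, and each
is a twin of an end of `K`. Two of them are twins of the same end, hence not adjacent. -/
theorem WalkUnique.arcs_lt_add_four (h : WalkUnique R k) (hk : 4 ≤ k) {A : Finset V}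
    (hA : A.card = k + 4) : arcs R A + 4 ≤ (k + 4).choose 2 := by
  by_contra hcon
  obtain ⟨x, hx, hxA⟩ := exists_erase_choose (R := R) (n := k + 3) (c := 2) hA (by omega)
    (by have : k + 3 + 1 = k + 4 := rfl; rw [this]; omega)
  have ax := arcs_erase (R := R) hx
  have nx := notMem_erase x A
  have cx := card_erase_add_one hx
  set A3 := A.erase x
  obtain ⟨y, hy, hyA⟩ := exists_erase_choose (R := R) (n := k + 2) (c := 1) (A := A3)
    (by omega) (by omega) (by have : k + 2 + 1 = k + 3 := rfl; rw [this]; omega)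
  have ay := arcs_erase (R := R) hy
  have ny := notMem_erase y A3
  have cy := card_erase_add_one hy
  have iy := insert_erase hy
  set A2 := A3.erase y
  obtain ⟨z, hz, hzA⟩ := exists_erase_choose (R := R) (n := k + 1) (c := 0) (A := A2)
    (by omega) (by omega) (by have : k + 1 + 1 = k + 2 := rfl; rw [this]; omega)
  have az := arcs_erase (R := R) hz
  have nz := notMem_erase z A2
  have cz := card_erase_add_one hz
  have iz := insert_erase hz
  set K := A2.erase z
  have hK : K.card = k + 1 := by omega
  obtain ⟨b1, b1'⟩ := h.arcs_bound hk K
  have b2 := h.arcs_lt_add_two hk (A := A2) (by omega)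
  have b3 := h.arcs_lt_add_three hk (A := A3) (by omega)
  rw [hK, if_neg (by omega), add_zero] at b1
  obtain ⟨-, p, hp⟩ := b1' (by omega) (by rw [hK]; omega)
  have e1 : (k + 4).choose 2 = (k + 3).choose 2 + (k + 3) := choose_two_succ _
  have e2 : (k + 3).choose 2 = (k + 2).choose 2 + (k + 2) := choose_two_succ _
  have e3 : (k + 2).choose 2 = (k + 1).choose 2 + (k + 1) := choose_two_succ _
  have yK : y ∉ K := fun c => ny (mem_of_mem_erase c)
  have xK : x ∉ K := fun c => nx (mem_of_mem_erase (mem_of_mem_erase c))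
  have hyA2 : deg R y A2 = ind R y z + ind R z y + deg R y K := by
    rw [← iz, deg_insert nz]
  have hxA3 : deg R x A3 = ind R x y + ind R y x + (ind R x z + ind R z x + deg R x K) := by
    rw [← iy, deg_insert ny, ← iz, deg_insert nz]
  -- a vertex that is almost completely joined to `K` is a twin of one of the ends
  have full : ∀ v ∉ K, k ≤ deg R v K + ind R v v → deg R v K = k ∧ ind R v v = 0 ∧
      ((∀ i, 1 ≤ i → i ≤ k → R v (p i)) ∨ (∀ i < k, R (p i) v)) := by
    intro v hv hd
    obtain ⟨d1, d2⟩ := hp.deg_le_and h hk hK hv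
    have hl : ind R v v = 0 := ind_eq_zero.2 fun c => by
      have := hp.deg_le_of_loop h (by omega) hv c
      have := ind_le_one (R := R) v v
      omega
    exact ⟨by omega, hl, d2 (by omega)⟩
  have hflip : ∀ v, (∀ i < k, R (p i) v) →
      ∀ i, 1 ≤ i → i ≤ k → _root_.flip R v (p (K.card - 1 - i)) := fun v hv i hi hi' =>
    hv _ (by omega)
  have le_one : ∀ v w, w ∉ K →
      ((∀ i, 1 ≤ i → i ≤ k → R v (p i)) ∨ (∀ i < k, R (p i) v)) → ind R w v + ind R v w ≤ 1 := by
    intro v w hw hv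
    by_contra! hcon
    have i1 := ind_le_one (R := R) w v
    have i2 := ind_le_one (R := R) v w
    have r1 : R w v := ind_eq_one.1 (by omega)
    have r2 : R v w := ind_eq_one.1 (by omega)
    rcases hv with hv | hv
    · exact hp.not_two_cycle_of_first h hk hK hw hv r2 r1
    · exact hp.flip.not_two_cycle_of_first h.flip hk hK hw (hflip v hv) r1 r2
  have nadj : ∀ v w, v ∉ K → w ∉ K →
      (∀ i, 1 ≤ i → i ≤ k → R v (p i)) → (∀ i, 1 ≤ i → i ≤ k → R w (p i)) →
      ind R v w + ind R w v = 0 := by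
    intro v w hv hw hv' hw'
    rw [ind_eq_zero.2 (hp.not_adj_of_first h hk hK hw hv' hw'),
      ind_eq_zero.2 (hp.not_adj_of_first h hk hK hv hw' hv')]
  have nadj' : ∀ v w, v ∉ K → w ∉ K → (∀ i < k, R (p i) v) → (∀ i < k, R (p i) w) →
      ind R v w + ind R w v = 0 := by
    intro v w hv hw hv' hw'
    have n1 : ¬ R v w :=
      hp.flip.not_adj_of_first h.flip hk hK hv (hflip w hw') (hflip v hv')
    have n2 : ¬ R w v :=
      hp.flip.not_adj_of_first h.flip hk hK hw (hflip v hv') (hflip w hw')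
    rw [ind_eq_zero.2 n1, ind_eq_zero.2 n2]
  -- The order matters: once `z` is a twin of an end, at most one arc joins it to `y`, which forces
  -- degree `k` of `y` into `K`; then the same for `x`.
  obtain ⟨dz, lz, tz⟩ := full z nz (by omega)
  have yz := le_one z y yK tz
  obtain ⟨dy, ly, ty⟩ := full y yK (by omega)
  have xz := le_one z x xK tz
  have xy := le_one y x xK ty
  obtain ⟨dx, lx, tx⟩ := full x xK (by omega)
  rcases tx with tx | tx <;> rcases ty with ty | ty <;> rcases tz with tz | tz
  · have := nadj x y xK yK tx ty; omega
  · have := nadj x y xK yK tx ty; omega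
  · have := nadj x z xK nz tx tz; omega
  · have := nadj' y z yK nz ty tz; omega
  · have := nadj y z yK nz ty tz; omega
  · have := nadj' x z xK nz tx tz; omega
  · have := nadj' x y xK yK tx ty; omega
  · have := nadj' x y xK yK tx ty; omega

/-- An excess would survive suitable deletions down to order `k + 4`, where `turanSize` has deficit
exactly 4. -/
theorem WalkUnique.arcs_le_turanSize (h : WalkUnique R k) (hk : 4 ≤ k) {n : ℕ} (hn : k + 4 ≤ n)
    {A : Finset V} (hA : A.card = n) : arcs R A ≤ turanSize k n := by
  induction n, hn using Nat.le_induction generalizing A with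
  | base =>
    have h1 := h.arcs_lt_add_four hk hA
    have h2 := turanSize_add (k := k) 4 hk
    omega
  | succ n hn ih =>
    by_contra! hcon
    obtain ⟨v, hv, hvA⟩ := exists_erase_turanSize (R := R) (e := 1) hk hA hn le_rfl hcon
    have := ih (A := A.erase v) (by have := card_erase_add_one hv; omega)
    omega

end Upper

/-! ### Detours in transitive tournaments and in almost transitive paths -/

section Paths

variable {V : Type*} {R : V → V → Prop} {k : ℕ}

/-- In a transitive tournament of order `k`, no walk `u, v, w` can be put in place of the vertex
with index `i`. -/
theorem WalkUnique.not_detour (h : WalkUnique R k) (hk : 5 ≤ k) {p : ℕ → V}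
    (hp : ∀ i j, i < j → j < k → R (p i) (p j)) (hne : ∀ i, i + 1 < k → p i ≠ p (i + 1))
    {i : ℕ} (hi : i < k) {u v w : V} (huv : R u v) (hvw : R v w) (hu : ∀ t < i, R (p t) u)
    (hw : ∀ t, i < t → t < k → R w (p t)) (hpu : ∀ t, t + 1 = i → p t ≠ u) : False := by
  -- `H` lists `p` with `u, v, w` in place of `p i`, a walk of length `k + 1`. Inner vertices other
  -- than these three can be skipped, and `k ≥ 5` leaves at least two.
  obtain ⟨H, H1, H2, H3, H4, H5⟩ : ∃ H : ℕ → V, (∀ t < i, H t = p t) ∧ H i = u ∧ H (i + 1) = v ∧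
      H (i + 2) = w ∧ ∀ t, i + 1 ≤ t → H (t + 2) = p t := by
    refine ⟨fun t => if t < i then p t else if t = i then u else if t = i + 1 then v else
      if t = i + 2 then w else p (t - 2), fun t ht => ?_, ?_, ?_, ?_, fun t ht => ?_⟩
    · simp [ht]
    · simp
    · simp
    · simp
    · simp [show ¬ t + 2 < i by omega, show t + 2 ≠ i by omega, show t + 1 ≠ i by omega,
        show t ≠ i by omega]
  have hH : ∀ t ≤ k, R (H t) (H (t + 1)) := by
    intro t ht
    rcases (show t + 1 < i ∨ t + 1 = i ∨ t = i ∨ t = i + 1 ∨ t = i + 2 ∨ i + 3 ≤ t by omega)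
      with c | c | rfl | rfl | rfl | c
    · rw [H1 t (by omega), H1 (t + 1) c]
      exact hp _ _ (by omega) (by omega)
    · rw [H1 t (by omega), c, H2]
      exact hu t (by omega)
    · rwa [H2, H3]
    · rwa [H3, H4]
    · rw [H4, show i + 2 + 1 = i + 1 + 2 by omega, H5 _ (by omega)]
      exact hw _ (by omega) (by omega)
    · obtain ⟨s, rfl⟩ : ∃ s, t = s + 2 := ⟨t - 2, by omega⟩
      rw [H5 s (by omega), show s + 2 + 1 = s + 1 + 2 by omega, H5 _ (by omega)]
      exact hp _ _ (by omega) (by omega)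
  have hskip : ∀ a, 1 ≤ a → a ≤ k → (a < i ∨ i + 2 < a) →
      R (H (a - 1)) (H (a + 1)) ∧ H a ≠ H (a + 1) := by
    intro a ha hak hai
    rcases (show a + 1 < i ∨ a + 1 = i ∨ a = i + 3 ∨ i + 4 ≤ a by omega) with c | c | rfl | c
    · rw [H1 (a - 1) (by omega), H1 (a + 1) c, H1 a (by omega)]
      exact ⟨hp _ _ (by omega) (by omega), hne a (by omega)⟩
    · rw [H1 (a - 1) (by omega), H1 a (by omega), c, H2]
      exact ⟨hu _ (by omega), hpu a c⟩
    · rw [show i + 3 - 1 = i + 2 by omega, H4, show i + 3 + 1 = i + 2 + 2 by omega,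
        H5 _ (by omega), show i + 3 = i + 1 + 2 by omega, H5 _ (by omega)]
      exact ⟨hw _ (by omega) (by omega), hne _ (by omega)⟩
    · obtain ⟨s, rfl⟩ : ∃ s, a = s + 1 + 2 := ⟨a - 3, by omega⟩
      rw [show s + 1 + 2 - 1 = s + 2 by omega, show s + 1 + 2 + 1 = s + 2 + 2 by omega,
        H5 s (by omega), H5 (s + 1) (by omega), H5 (s + 2) (by omega)]
      exact ⟨hp _ _ (by omega) (by omega), hne _ (by omega)⟩
  obtain ⟨a, b, ha, hab, hb, hai, hbi⟩ : ∃ a b, 1 ≤ a ∧ a < b ∧ b ≤ k ∧ (a < i ∨ i + 2 < a) ∧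
      (b < i ∨ i + 2 < b) := by
    rcases (show i = 0 ∨ i = 1 ∨ i = 2 ∨ 3 ≤ i by omega) with c | c | c | c
    · exact ⟨3, 4, by omega⟩
    · exact ⟨4, 5, by omega⟩
    · exact ⟨1, 5, by omega⟩
    · exact ⟨1, 2, by omega⟩
  have ga := hskip a ha (by omega) hai
  exact ga.2 (h.skip hH ha hab hb ga.1 (hskip b (by omega) hb hbi).1)

/-- The in-neighbours of a further vertex precede its out-neighbours. -/
theorem IsTransEnum.lt_of_adj {p : ℕ → V} {K : Finset V} (hp : IsTransEnum R p K)
    (h : WalkUnique R k) (hk : 5 ≤ k) (hK : K.card = k) {v : V} {i j : ℕ} (hi : i < k)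
    (hj : j < k) (h1 : R (p i) v) (h2 : R v (p j)) : i < j := by
  by_contra hij
  have hadj : ∀ i j, i < j → j < k → R (p i) (p j) := fun i j hij hj =>
    hp.adj i j hij (by omega)
  have hne : ∀ i j, i < k → j < k → i ≠ j → p i ≠ p j := fun i j hi hj hij he =>
    hij (hp.inj (by omega) (by omega) he)
  rcases (not_lt.1 hij).eq_or_lt with rfl | hlt
  · exact h.not_detour hk hadj (fun t ht => hne _ _ (by omega) ht (by omega)) hi h1 h2
      (fun t ht => hadj _ _ ht hi) (fun t ht ht' => hadj _ _ ht ht')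
      (fun t ht => hne _ _ (by omega) hi (by omega))
  -- Here `p i, v, p j` replaces `p (j + 1)`: the vertices up to `p j` precede `p i`, those after `p
  -- (j + 1)` follow `p j`.
  · exact h.not_detour hk hadj (fun t ht => hne _ _ (by omega) ht (by omega))
      (show j + 1 < k by omega) h1 h2 (fun t ht => hadj _ _ (by omega) hi)
      (fun t ht ht' => hadj _ _ (by omega) ht') (fun t ht => hne _ _ (by omega) hi (by omega))

/-- Let all forward arcs of the path `q 0, …, q k` be present, but for one that joins two
vertices that are not consecutive. Then a further vertex has no arc to the first vertex. -/
theorem WalkUnique.not_adj_path_first (h : WalkUnique R k) (hk : 5 ≤ k) {q : ℕ → V} {α β : ℕ}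
    (hαβ : α + 2 ≤ β) (hq : ∀ s t, s < t → t ≤ k → ¬ (s = α ∧ t = β) → R (q s) (q t))
    (hne : ∀ s t, s < t → t ≤ k → q s ≠ q t) (u : V) : ¬ R u (q 0) := by
  intro hu
  -- In `u, q 0, …, q k`, skipping the vertex at place `a` needs the arc from `q (a - 2)` to `q a`,
  -- which can be absent only if `a - 2 = α`.
  obtain ⟨a, b, ha, hab, hb, h1, h2⟩ : ∃ a b, 2 ≤ a ∧ a < b ∧ b ≤ k ∧ a - 2 ≠ α ∧ b - 2 ≠ α := by
    rcases (show α = 0 ∨ α = 1 ∨ 2 ≤ α by omega) with c | c | c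
    · exact ⟨3, 4, by omega⟩
    · exact ⟨2, 4, by omega⟩
    · exact ⟨2, 3, by omega⟩
  have hskip : ∀ a, 2 ≤ a → a ≤ k → a - 2 ≠ α →
      R ((fun t => if t = 0 then u else q (t - 1)) (a - 1))
        ((fun t => if t = 0 then u else q (t - 1)) (a + 1)) := by
    intro a ha hak h1
    simpa [show a - 1 ≠ 0 by omega, show a - 1 - 1 = a - 2 by omega] using
      hq (a - 2) a (by omega) hak (by omega)
  have := h.skip (f := fun t => if t = 0 then u else q (t - 1)) (fun i hi => by
    rcases Nat.eq_zero_or_pos i with rfl | hi0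
    · simpa using hu
    · simpa [hi0.ne'] using hq (i - 1) i (by omega) (by omega) (by omega)) (by omega) hab hb
    (hskip a ha (by omega) h1) (hskip b (by omega) hb h2)
  exact hne (a - 1) a (by omega) (by omega) (by simpa [show a ≠ 0 by omega] using this)

/-- A vertex that is joined to all vertices but an inner one of such a path does not exist. -/
theorem WalkUnique.not_adj_path (h : WalkUnique R k) (hk : 5 ≤ k) {q : ℕ → V} {α β : ℕ}
    (hαβ : α + 2 ≤ β) (hβ : β ≤ k)
    (hq : ∀ s t, s < t → t ≤ k → ¬ (s = α ∧ t = β) → R (q s) (q t))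
    (hne : ∀ s t, s < t → t ≤ k → q s ≠ q t) {u : V} (huq : ∀ t ≤ k, q t ≠ u) {c : ℕ}
    (hc0 : 0 < c) (hck : c < k) (hu : ∀ t ≤ k, t ≠ c → R u (q t) ∨ R (q t) u) : False := by
  have h0 : ¬ R u (q 0) := h.not_adj_path_first hk hαβ hq hne u
  have hlast : ¬ R (q k) u := by
    have : ¬ R (q (k - 0)) u := h.flip.not_adj_path_first hk (q := fun t => q (k - t)) (α := k - β) (β := k - α)
      (by omega) (fun s t hst ht hs => hq _ _ (by omega) (by omega) (by omega))
      (fun s t hst ht => (hne _ _ (by omega) (by omega)).symm) u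
    simpa using this
  classical
  have hq1 : ∀ t < k, R (q t) (q (t + 1)) := fun t ht =>
    hq t (t + 1) (by omega) (by omega) (by omega)
  -- `q i` is the last in-neighbour of `u`. If `i + 1 = c`, then `u` can replace `q c`, which gives
  -- a second walk of length `k`. Otherwise `u` fits in between `q i` and `q (i + 1)`, and in the
  -- longer walk both `u` and a second vertex can be skipped.
  obtain ⟨i, hi, him⟩ := exists_max_image ((range k).filter fun i => R (q i) u) id
    ⟨0, mem_filter.2 ⟨mem_range.2 (by omega), (hu 0 (by omega) (by omega)).resolve_left h0⟩⟩
  obtain ⟨hik, hiu⟩ := mem_filter.1 hi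
  rw [mem_range] at hik
  have hout : ∀ t, i < t → t ≤ k → t ≠ c → R u (q t) := by
    intro t hit ht htc
    refine (hu t ht htc).resolve_right fun htu => ?_
    rcases ht.eq_or_lt with rfl | hlt
    · exact hlast htu
    · have : t ≤ i := him t (mem_filter.2 ⟨mem_range.2 hlt, htu⟩)
      omega
  by_cases hic : i + 1 = c
  · have hout' := hout (i + 2) (by omega) (by omega) (by omega)
    have := h (fun t => if t = i + 1 then u else q t) q (fun t ht => by
      rcases (show t = i ∨ t = i + 1 ∨ t ≠ i ∧ t ≠ i + 1 by omega) with rfl | rfl | ⟨c1, c2⟩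
      · simpa using hiu
      · simpa using hout'
      · simpa [c1, c2] using hq1 t ht) hq1 (by simp) (by simp [show k ≠ i + 1 by omega])
      (i + 1) (by omega)
    exact huq (i + 1) (by omega) (by simpa using this.symm)
  · have hui := hout (i + 1) (by omega) (by omega) hic
    obtain ⟨H, H1, H2, H3⟩ : ∃ H : ℕ → V, (∀ t ≤ i, H t = q t) ∧ H (i + 1) = u ∧
        ∀ t, i + 1 ≤ t → H (t + 1) = q t := by
      refine ⟨fun t => if t ≤ i then q t else if t = i + 1 then u else q (t - 1), fun t ht => ?_,
        ?_, fun t ht => ?_⟩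
      · simp [ht]
      · simp
      · simp [show ¬ t + 1 ≤ i by omega, show t ≠ i by omega]
    have hH : ∀ t ≤ k, R (H t) (H (t + 1)) := by
      intro t ht
      rcases (show t < i ∨ t = i ∨ t = i + 1 ∨ i + 2 ≤ t by omega) with c | rfl | rfl | c
      · rw [H1 t c.le, H1 (t + 1) c]
        exact hq1 t (by omega)
      · rwa [H1 _ le_rfl, H2]
      · rwa [H2, H3 _ le_rfl]
      · obtain ⟨s, rfl⟩ : ∃ s, t = s + 1 := ⟨t - 1, by omega⟩
        rw [H3 s (by omega), H3 (s + 1) (by omega)]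
        exact hq1 s (by omega)
    have hHne : ∀ t, 1 ≤ t → t ≤ k → H t ≠ H (t + 1) := by
      intro t ht0 ht
      rcases (show t < i ∨ t = i ∨ t = i + 1 ∨ i + 2 ≤ t by omega) with c | rfl | rfl | c
      · rw [H1 t c.le, H1 (t + 1) c]
        exact hne _ _ (by omega) (by omega)
      · rw [H1 _ le_rfl, H2]
        exact huq _ (by omega)
      · rw [H2, H3 _ le_rfl]
        exact (huq _ (by omega)).symm
      · obtain ⟨s, rfl⟩ : ∃ s, t = s + 1 := ⟨t - 1, by omega⟩
        rw [H3 s (by omega), H3 (s + 1) (by omega)]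
        exact hne _ _ (by omega) (by omega)
    have hsu : R (H (i + 1 - 1)) (H (i + 1 + 1)) := by
      rw [Nat.add_sub_cancel, H1 _ le_rfl, H3 _ le_rfl]
      exact hq1 i hik
    -- The place of the second vertex to be skipped; the two excluded values are those for which the
    -- shortcut would start at `q α`.
    obtain ⟨y, hy1, hyk, hyi⟩ : ∃ y, 1 ≤ y ∧ y ≤ k ∧
        (y < i ∧ y ≠ α + 1 ∨ i + 2 < y ∧ y ≠ α + 2) := by
      by_contra! hcon
      have g1 := hcon 1
      have g2 := hcon 2
      have g3 := hcon 3
      have g4 := hcon 4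
      have g5 := hcon 5
      omega
    have hsy : R (H (y - 1)) (H (y + 1)) := by
      rcases hyi with ⟨c, c'⟩ | ⟨c, c'⟩
      · rw [H1 _ (by omega), H1 _ (by omega)]
        exact hq _ _ (by omega) (by omega) (by omega)
      · obtain ⟨s, rfl⟩ : ∃ s, y = s + 2 := ⟨y - 2, by omega⟩
        rw [show s + 2 - 1 = s + 1 by omega, H3 _ (by omega), H3 _ (by omega)]
        exact hq _ _ (by omega) (by omega) (by omega)
    rcases lt_or_ge y (i + 1) with c | c
    · exact hHne y hy1 hyk (h.skip hH hy1 c (by omega) hsy hsu)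
    · exact hHne (i + 1) (by omega) (by omega)
        (h.skip hH (by omega) (show i + 1 < y by omega) hyk hsu hsy)

end Paths

/-! ### Extremal digraphs of order `k + 5` -/

section Extremal

variable {V : Type*} {R : V → V → Prop} {k : ℕ}

theorem IsTransEnum.choose_le_arcs {p : ℕ → V} {K : Finset V} (hp : IsTransEnum R p K) :
    K.card.choose 2 ≤ arcs R K := by
  have h1 : arcs R K = ∑ j ∈ range K.card, ∑ i ∈ range K.card, ind R (p i) (p j) := by
    unfold arcs
    rw [sum_comm, hp.sum]
    exact sum_congr rfl fun j _ => hp.sum _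
  have h2 : ∑ j ∈ range K.card, j ≤ ∑ j ∈ range K.card, ∑ i ∈ range K.card, ind R (p i) (p j) := by
    refine sum_le_sum fun j hj => ?_
    rw [mem_range] at hj
    calc j = ∑ i ∈ range j, 1 := by simp
      _ = ∑ i ∈ range j, ind R (p i) (p j) := sum_congr rfl fun i hi =>
        (ind_eq_one.2 (hp.adj i j (mem_range.1 hi) hj)).symm
      _ ≤ _ := sum_le_sum_of_subset (range_subset_range.2 hj.le)
  have h3 : ∑ j ∈ range K.card, j = K.card.choose 2 := by
    generalize K.card = n
    induction n with
    | zero => rfl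
    | succ n ih => rw [sum_range_succ, ih, choose_two_succ]
  omega

variable [DecidableEq V]

/-- A dense digraph contains a dense digraph of smaller order. -/
theorem exists_subset_choose {n : ℕ} (hn : 1 ≤ n) (c : ℕ) {A : Finset V} (hA : A.card = n + c)
    (h : (n + c).choose 2 ≤ arcs R A + c) : ∃ K ⊆ A, K.card = n ∧ n.choose 2 ≤ arcs R K := by
  induction c generalizing A with
  | zero => exact ⟨A, Subset.rfl, hA, h⟩
  | succ c ih =>
    obtain ⟨v, hv, hvA⟩ := exists_erase_choose (R := R) (n := n + c) (c := c) hA (by omega) h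
    obtain ⟨K, hK, hK'⟩ := ih (A := A.erase v) (by have := card_erase_add_one hv; omega) hvA
    exact ⟨K, hK.trans (erase_subset v A), hK'⟩

/-- The assumptions on an extremal digraph of order `k + 5`. -/
structure IsExtremalFive (R : V → V → Prop) (k : ℕ) (A : Finset V) : Prop where
  unique : WalkUnique R k
  le : 5 ≤ k
  card : A.card = k + 5
  arcs_eq : arcs R A + 5 = (k + 5).choose 2

variable {A : Finset V}

/-- Since each `A - w` has deficit at least 4, every `w` has degree at least `k + 3`. If `K` were
full, summation over the four vertices outside would force seven arcs among them, but there are at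
most six. -/
theorem IsExtremalFive.arcs_lt (h : IsExtremalFive R k A) {K : Finset V} (hKA : K ⊆ A)
    (hK : K.card = k + 1) : arcs R K + 1 ≤ (k + 1).choose 2 := by
  obtain ⟨hw, hk, hA, he⟩ := h
  obtain ⟨b1, -⟩ := hw.arcs_bound (by omega) K
  rw [hK, if_neg (by omega)] at b1
  by_contra hcon
  have hAu : A = K ∪ (A \ K) := (union_sdiff_of_subset hKA).symm
  have cW : (A \ K).card = 4 := by
    have := card_sdiff_add_card_eq_card hKA
    omega
  obtain ⟨b4, -⟩ := hw.arcs_bound (by omega) (A \ K)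
  rw [cW, if_neg (by omega), show Nat.choose 4 2 = 6 from rfl] at b4
  have hAa : arcs R A = arcs R K + arcs R (A \ K) + ∑ w ∈ A \ K, deg R w K := by
    conv_lhs => rw [hAu]
    exact arcs_union disjoint_sdiff
  have e1 : (k + 5).choose 2 = (k + 4).choose 2 + (k + 4) := choose_two_succ _
  have e2 : (k + 4).choose 2 = (k + 3).choose 2 + (k + 3) := choose_two_succ _
  have e3 : (k + 3).choose 2 = (k + 2).choose 2 + (k + 2) := choose_two_succ _
  have e4 : (k + 2).choose 2 = (k + 1).choose 2 + (k + 1) := choose_two_succ _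
  have hdeg : ∀ w ∈ A \ K, k + 3 ≤ deg R w K + deg R w (A \ K) := by
    intro w hw'
    have hwA := (mem_sdiff.1 hw').1
    have h4 := hw.arcs_lt_add_four (by omega) (A := A.erase w)
      (by have := card_erase_add_one hwA; omega)
    have h5 := arcs_erase (R := R) hwA
    have h6 := deg_erase (R := R) hwA
    have h7 : deg R w A = deg R w K + deg R w (A \ K) := by
      conv_lhs => rw [hAu]
      exact deg_union disjoint_sdiff
    omega
  have hs : ∑ w ∈ A \ K, (k + 3) ≤ ∑ w ∈ A \ K, (deg R w K + deg R w (A \ K)) := sum_le_sum hdeg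
  rw [sum_const, sum_add_distrib, sum_deg, cW, smul_eq_mul] at hs
  omega

theorem IsExtremalFive.exists_isTransEnum (h : IsExtremalFive R k A) :
    ∃ K ⊆ A, K.card = k ∧ ∃ p, IsTransEnum R p K := by
  obtain ⟨K, hKA, hK, hK'⟩ := exists_subset_choose (R := R) (A := A) (n := k)
    (by have := h.le; omega) 5 h.card h.arcs_eq.ge
  have := h.le
  obtain ⟨b1, b2⟩ := h.unique.arcs_bound (by omega) K
  rw [hK, if_neg (by omega)] at b1
  exact ⟨K, hKA, hK, (b2 (by omega) (by rw [hK]; omega)).2⟩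

/-- `x` is the index of the only vertex in the list `p` of length `k` not joined to `w`. -/
def IsMissing (R : V → V → Prop) (k : ℕ) (p : ℕ → V) (w : V) (x : ℕ) : Prop :=
  x < k ∧ ¬ R w (p x) ∧ ¬ R (p x) w ∧ ∀ i < k, i ≠ x → R w (p i) ∨ R (p i) w

theorem IsExtremalFive.oriented (h : IsExtremalFive R k A) {K : Finset V}
    (hK : K.card = k) {p : ℕ → V} (hp : IsTransEnum R p K) :
    arcs R K = k.choose 2 ∧ Oriented R K := by
  have h1 := hp.choose_le_arcs
  have := h.le
  obtain ⟨b1, b2⟩ := h.unique.arcs_bound (by omega) K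
  rw [hK] at h1 b1 b2
  rw [if_neg (by omega)] at b1
  exact ⟨by omega, (b2 (by omega) (by omega)).1⟩

/-- No vertex outside is joined to all of `K`, as this would give a full set of order `k + 1`. So
each of the five accounts for a missing arc; the deficit is five, and nothing else is missing. -/
theorem IsExtremalFive.outside (h : IsExtremalFive R k A) {K : Finset V} (hKA : K ⊆ A)
    (hK : K.card = k) {p : ℕ → V} (hp : IsTransEnum R p K) :
    (∀ w ∈ A \ K, deg R w K + 1 = k ∧ ∃ x, IsMissing R k p w x) ∧ Oriented R (A \ K) ∧
      ∀ v ∈ A \ K, ∀ w ∈ A \ K, v ≠ w → R v w ∨ R w v := by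
  have hk := h.le
  have hAu : A = K ∪ (A \ K) := (union_sdiff_of_subset hKA).symm
  obtain ⟨hKa, hKo⟩ := h.oriented hK hp
  have hg1 : ∀ w, ∀ i < k, ind R w (p i) + ind R (p i) w ≤ 1 := fun w i hi => by
    by_cases c : R (p i) w
    · have : ¬ R w (p i) := fun c' => (hp.lt_of_adj h.unique hk hK hi hi c c').false
      simpa [ind_eq_zero.2 this] using ind_le_one _ _
    · simpa [ind_eq_zero.2 c] using ind_le_one _ _
  have hzero : ∀ w ∈ A \ K, ∃ x < k, ind R w (p x) + ind R (p x) w = 0 := by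
    intro w hw
    by_contra! hcon
    have hd : deg R w K = k := by
      rw [hp.deg_eq, hK]
      calc _ = ∑ i ∈ range k, 1 := sum_congr rfl fun i hi => by
            have := hg1 w i (mem_range.1 hi)
            have := hcon i (mem_range.1 hi)
            omega
        _ = k := by simp
    have hwK := (mem_sdiff.1 hw).2
    have h1 := h.arcs_lt (K := insert w K) (insert_subset (mem_sdiff.1 hw).1 hKA)
      (by rw [card_insert_of_notMem hwK, hK])
    rw [arcs_insert hwK, hd, hKa, choose_two_succ] at h1
    omega
  have hle : ∀ w ∈ A \ K, deg R w K + 1 ≤ k := by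
    intro w hw
    obtain ⟨x, hx, hx0⟩ := hzero w hw
    rw [hp.deg_eq, hK]
    exact (sum_range_le_of_zero (hg1 w) hx hx0).1
  have cW : (A \ K).card = 5 := by
    have := card_sdiff_add_card_eq_card hKA
    have := h.card
    omega
  obtain ⟨b5, b5'⟩ := h.unique.arcs_bound (by omega) (A \ K)
  rw [cW, if_neg (by omega), show Nat.choose 5 2 = 10 from rfl] at b5
  rw [cW, show Nat.choose 5 2 = 10 from rfl] at b5'
  have hAa : arcs R A = arcs R K + arcs R (A \ K) + ∑ w ∈ A \ K, deg R w K := by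
    conv_lhs => rw [hAu]
    exact arcs_union disjoint_sdiff
  have hs : ∑ w ∈ A \ K, (deg R w K + 1) ≤ ∑ w ∈ A \ K, k := sum_le_sum hle
  have hs' := hs
  rw [sum_add_distrib, sum_const, sum_const, cW, smul_eq_mul, smul_eq_mul] at hs'
  have e0 : (k + 5).choose 2 = k.choose 2 + 10 + k * 5 := choose_two_add k 5
  have he := h.arcs_eq
  have hsum : ∑ w ∈ A \ K, (deg R w K + 1) = ∑ w ∈ A \ K, k := by
    refine le_antisymm hs ?_
    rw [sum_add_distrib, sum_const, sum_const, cW, smul_eq_mul, smul_eq_mul]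
    omega
  have hall := (sum_eq_sum_iff_of_le hle).1 hsum
  obtain ⟨ho, q, hq⟩ := b5' le_rfl (by omega)
  refine ⟨fun w hw => ⟨hall w hw, ?_⟩, ho, fun v hv w hw hvw => ?_⟩
  · obtain ⟨x, hx, hx0⟩ := hzero w hw
    have hd := hall w hw
    rw [hp.deg_eq, hK] at hd
    have h1 := (sum_range_le_of_zero (hg1 w) hx hx0).2 hd
    refine ⟨x, hx, ind_eq_zero.1 (by omega), ind_eq_zero.1 (by omega), fun i hi hix => ?_⟩
    have h2 := h1 i hi hix
    by_contra! hno
    rw [ind_eq_zero.2 hno.1, ind_eq_zero.2 hno.2] at h2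
    omega
  · obtain ⟨i, hi, rfl⟩ := hq.surj v hv
    obtain ⟨j, hj, rfl⟩ := hq.surj w hw
    rcases lt_trichotomy i j with c | rfl | c
    · exact Or.inl (hq.adj _ _ c hj)
    · exact (hvw rfl).elim
    · exact Or.inr (hq.adj _ _ c hi)

/-- Otherwise `v` and `w` together could replace `p x`, against `IsExtremalFive.arcs_lt`. -/
theorem IsExtremalFive.missing_inj (h : IsExtremalFive R k A) {K : Finset V} (hKA : K ⊆ A)
    (hK : K.card = k) {p : ℕ → V} (hp : IsTransEnum R p K) {v w : V} (hv : v ∈ A \ K)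
    (hw : w ∈ A \ K) {x : ℕ} (hvx : IsMissing R k p v x) (hwx : IsMissing R k p w x) : v = w := by
  by_contra hvw
  obtain ⟨h1, -, h3⟩ := h.outside hKA hK hp
  obtain ⟨hKa, hKo⟩ := h.oriented hK hp
  have hx : p x ∈ K := hp.mem x (by have := hvx.1; omega)
  have hvK := (mem_sdiff.1 hv).2
  have hwK := (mem_sdiff.1 hw).2
  have hwL : w ∉ K.erase (p x) := fun c => hwK (mem_of_mem_erase c)
  have hvL : v ∉ K.erase (p x) := fun c => hvK (mem_of_mem_erase c)
  have hvL' : v ∉ insert w (K.erase (p x)) := by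
    rw [mem_insert, not_or]
    exact ⟨hvw, hvL⟩
  have c1 := card_erase_add_one hx
  have hd : ∀ u, IsMissing R k p u x → deg R u (K.erase (p x)) = deg R u K := by
    intro u hu
    conv_rhs => rw [← insert_erase hx]
    rw [deg_insert (notMem_erase _ _), ind_eq_zero.2 hu.2.1, ind_eq_zero.2 hu.2.2.1]
    ring
  have hA := h.arcs_lt (K := insert v (insert w (K.erase (p x))))
    (insert_subset (mem_sdiff.1 hv).1 (insert_subset (mem_sdiff.1 hw).1
      ((erase_subset _ _).trans hKA)))
    (by rw [card_insert_of_notMem hvL', card_insert_of_notMem hwL]; omega)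
  rw [arcs_insert hvL', arcs_insert hwL, deg_insert hwL, hd v hvx, hd w hwx, choose_two_succ] at hA
  have h4 := arcs_erase (R := R) hx
  have h5 : deg R (p x) (K.erase (p x)) ≤ (K.erase (p x)).card :=
    deg_le_card fun u hu => hKo u (mem_of_mem_erase hu) _ hx
  have h6 : ind R (p x) (p x) = 0 := ind_eq_zero.2 fun c => hKo _ hx _ hx c c
  have h7 := (h1 v hv).1
  have h8 := (h1 w hw).1
  have h9 : 1 ≤ ind R v w + ind R w v := by
    rcases h3 v hv w hw hvw with c | c
    · rw [ind_eq_one.2 c]; omega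
    · rw [ind_eq_one.2 c]; omega
  omega

/-- A vertex outside a transitive tournament of order `k` is a twin of one of its vertices. -/
theorem IsExtremalFive.twin (h : IsExtremalFive R k A) {K : Finset V} (hKA : K ⊆ A)
    (hK : K.card = k) {p : ℕ → V} (hp : IsTransEnum R p K) {w : V} (hw : w ∈ A \ K)
    {x : ℕ} (hx : IsMissing R k p w x) :
    ∀ i < k, (R (p i) w ↔ i < x) ∧ (R w (p i) ↔ x < i) := by
  classical
  have hk := h.le
  obtain ⟨h1, -, h3⟩ := h.outside hKA hK hp
  have hwK := (mem_sdiff.1 hw).2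
  have hex : ∃ i, k ≤ i ∨ R w (p i) := ⟨k, Or.inl le_rfl⟩
  -- `a` separates the in-neighbours of `w` from its out-neighbours. As index `x` is exempt, both `a
  -- = x` and `a = x + 1` describe a twin of `p x`.
  obtain ⟨a, hak, hin, hout⟩ : ∃ a ≤ k, (∀ i < a, i ≠ x → R (p i) w) ∧
      ∀ i, a ≤ i → i < k → i ≠ x → R w (p i) := by
    refine ⟨Nat.find hex, Nat.find_min' hex (Or.inl le_rfl), fun i hi hix => ?_,
      fun i hi hik hix => ?_⟩
    · have := Nat.find_min hex hi
      push Not at this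
      exact (hx.2.2.2 i this.1 hix).resolve_left this.2
    · refine (hx.2.2.2 i hik hix).resolve_right fun c => ?_
      have h5 : R w (p (Nat.find hex)) := (Nat.find_spec hex).resolve_left (by omega)
      have := hp.lt_of_adj h.unique hk hK hik (by omega) c h5
      omega
  have hnot : ∀ i < k, ¬ (R (p i) w ∧ R w (p i)) := fun i hi c =>
    (hp.lt_of_adj h.unique hk hK hi hi c.1 c.2).false
  have hxk := hx.1
  by_cases hgood : a = x ∨ a = x + 1
  · intro i hi
    rcases lt_trichotomy i x with c | rfl | c
    · have hi' : R (p i) w := hin i (by omega) (by omega)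
      exact ⟨iff_of_true hi' c, iff_of_false (fun c' => hnot i hi ⟨hi', c'⟩) (by omega)⟩
    · exact ⟨iff_of_false hx.2.2.1 (by omega), iff_of_false hx.2.1 (by omega)⟩
    · have hi' : R w (p i) := hout i (by omega) hi (by omega)
      exact ⟨iff_of_false (fun c' => hnot i hi ⟨c', hi'⟩) (by omega), iff_of_true hi' c⟩
  exfalso
  -- another vertex `u` outside, twin of none of the ends
  have hcard : ((A \ K).erase w).card = 4 := by
    have := card_sdiff_add_card_eq_card hKA
    have := card_erase_add_one hw
    have := h.card
    omega
  choose! m hm using fun v hv => (h1 v hv).2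
  -- Different vertices miss different indices, so at most two of the other four miss an end.
  obtain ⟨u, hu, hu0, huk⟩ : ∃ u ∈ (A \ K).erase w, m u ≠ 0 ∧ m u ≠ k - 1 := by
    by_contra! hcon
    have hmap : ∀ v ∈ (A \ K).erase w, m v ∈ ({0, k - 1} : Finset ℕ) := by
      intro v hv
      rw [mem_insert, mem_singleton]
      by_cases c : m v = 0
      · exact Or.inl c
      · exact Or.inr (hcon v hv c)
    have hlt : ({0, k - 1} : Finset ℕ).card < ((A \ K).erase w).card := by
      have := card_le_two (a := 0) (b := k - 1)
      omega
    obtain ⟨v, hv, v', hv', hne, he⟩ := exists_ne_map_eq_of_card_lt_of_maps_to hlt hmap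
    have hvW := mem_of_mem_erase hv
    have hvW' := mem_of_mem_erase hv'
    exact hne (h.missing_inj hKA hK hp hvW hvW' (hm v hvW) (he ▸ hm v' hvW'))
  have huW := mem_of_mem_erase hu
  have huw : u ≠ w := ne_of_mem_erase hu
  obtain ⟨mk, -, -, mu⟩ := hm u huW
  have huK := (mem_sdiff.1 huW).2
  -- `q` is `p` with `w` inserted at place `a`. The only forward arc it lacks is the one between `w`
  -- and `p x`, which are not consecutive by the choice of case; and `u` is joined to all of `q` but
  -- one inner vertex.
  obtain ⟨q, q1, q2, q3⟩ : ∃ q : ℕ → V, (∀ t < a, q t = p t) ∧ q a = w ∧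
      ∀ t, a ≤ t → q (t + 1) = p t := by
    refine ⟨fun t => if t < a then p t else if t = a then w else p (t - 1), fun t ht => ?_, ?_,
      fun t ht => ?_⟩
    · simp [ht]
    · simp
    · simp [show ¬ t + 1 < a by omega, show t + 1 ≠ a by omega]
  have hpne : ∀ i j, i < k → j < k → i ≠ j → p i ≠ p j := fun i j hi hj hij he =>
    hij (hp.inj (by omega) (by omega) he)
  have hpw : ∀ i < k, p i ≠ w := fun i hi => hp.ne hwK (by omega)
  have hpu : ∀ i < k, p i ≠ u := fun i hi => hp.ne huK (by omega)
  have hadj : ∀ i j, i < j → j < k → R (p i) (p j) := fun i j hij hj =>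
    hp.adj i j hij (by omega)
  have hq : ∀ s t, s < t → t ≤ k → (t = a → s ≠ x) → (s = a → t ≠ x + 1) → R (q s) (q t) := by
    intro s t hst htk e1 e2
    rcases lt_trichotomy t a with c | rfl | c
    · rw [q1 t c, q1 s (by omega)]
      exact hadj _ _ hst (by omega)
    · rw [q2, q1 s hst]
      exact hin s hst (e1 rfl)
    · obtain ⟨t, rfl⟩ : ∃ t', t = t' + 1 := ⟨t - 1, by omega⟩
      rw [q3 t (by omega)]
      rcases lt_trichotomy s a with c' | rfl | c'
      · rw [q1 s c']
        exact hadj _ _ (by omega) (by omega)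
      · rw [q2]
        exact hout t (by omega) (by omega) (by have := e2 rfl; omega)
      · obtain ⟨s, rfl⟩ : ∃ s', s = s' + 1 := ⟨s - 1, by omega⟩
        rw [q3 s (by omega)]
        exact hadj _ _ (by omega) (by omega)
  have hqne : ∀ s t, s < t → t ≤ k → q s ≠ q t := by
    intro s t hst htk
    rcases lt_trichotomy t a with c | rfl | c
    · rw [q1 t c, q1 s (by omega)]
      exact hpne _ _ (by omega) (by omega) (by omega)
    · rw [q2, q1 s hst]
      exact hpw s (by omega)
    · obtain ⟨t, rfl⟩ : ∃ t', t = t' + 1 := ⟨t - 1, by omega⟩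
      rw [q3 t (by omega)]
      rcases lt_trichotomy s a with c' | rfl | c'
      · rw [q1 s c']
        exact hpne _ _ (by omega) (by omega) (by omega)
      · rw [q2]
        exact (hpw t (by omega)).symm
      · obtain ⟨s, rfl⟩ : ∃ s', s = s' + 1 := ⟨s - 1, by omega⟩
        rw [q3 s (by omega)]
        exact hpne _ _ (by omega) (by omega) (by omega)
  have hqu : ∀ t ≤ k, q t ≠ u := by
    intro t ht
    rcases lt_trichotomy t a with c | rfl | c
    · rw [q1 t c]; exact hpu t (by omega)
    · rw [q2]; exact huw.symm
    · obtain ⟨t, rfl⟩ : ∃ t', t = t' + 1 := ⟨t - 1, by omega⟩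
      rw [q3 t (by omega)]; exact hpu t (by omega)
  have huadj : ∀ t ≤ k, t ≠ (if m u < a then m u else m u + 1) → R u (q t) ∨ R (q t) u := by
    intro t ht htm
    rcases lt_trichotomy t a with c | rfl | c
    · rw [q1 t c]
      exact mu t (by omega) (by split_ifs at htm <;> omega)
    · rw [q2]
      exact h3 u huW w hw huw
    · obtain ⟨t, rfl⟩ : ∃ t', t = t' + 1 := ⟨t - 1, by omega⟩
      rw [q3 t (by omega)]
      exact mu t (by omega) (by split_ifs at htm <;> omega)
  have hc0 : 0 < (if m u < a then m u else m u + 1) := by split_ifs <;> omega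
  have hck : (if m u < a then m u else m u + 1) < k := by split_ifs <;> omega
  rcases lt_or_ge x a with c | c
  · exact h.unique.not_adj_path hk (α := x) (β := a) (by omega) hak
      (fun s t hst ht he => hq s t hst ht (fun e1 e2 => he ⟨e2, e1⟩) (by omega)) hqne hqu hc0 hck
      huadj
  · exact h.unique.not_adj_path hk (α := a) (β := x + 1) (by omega) (by omega)
      (fun s t hst ht he => hq s t hst ht (by omega) (fun e1 e2 => he ⟨e1, e2⟩)) hqne hqu hc0 hck
      huadj

/-- The arcs inside `A` are those that go up with respect to `ℓ`, and the `k` levels have almost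
the same size. -/
structure IsLeveled (R : V → V → Prop) (k : ℕ) (A : Finset V) (ℓ : V → ℕ) : Prop where
  lt : ∀ v ∈ A, ℓ v < k
  adj : ∀ u ∈ A, ∀ v ∈ A, R u v ↔ ℓ u < ℓ v
  balanced : ∀ i < k, ∀ j < k, (A.filter fun v => ℓ v = i).card ≤
    (A.filter fun v => ℓ v = j).card + 1

/-- The level of a vertex is its own index in `p`, or else the index that it misses. By
`missing_inj` each level has one or two vertices. -/
theorem IsExtremalFive.exists_isLeveled (h : IsExtremalFive R k A) :
    ∃ ℓ, IsLeveled R k A ℓ := by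
  obtain ⟨K, hKA, hK, p, hp⟩ := h.exists_isTransEnum
  obtain ⟨h1, h2, h3⟩ := h.outside hKA hK hp
  obtain ⟨-, hKo⟩ := h.oriented hK hp
  have hex : ∀ v ∈ A, ∃ i < k, (v ∈ K → p i = v) ∧ (v ∉ K → IsMissing R k p v i) := by
    intro v hv
    by_cases hvK : v ∈ K
    · obtain ⟨i, hi, hi'⟩ := hp.surj v hvK
      exact ⟨i, by omega, fun _ => hi', fun c => (c hvK).elim⟩
    · obtain ⟨x, hx⟩ := (h1 v (mem_sdiff.2 ⟨hv, hvK⟩)).2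
      exact ⟨x, hx.1, fun c => (hvK c).elim, fun _ => hx⟩
  choose! ℓ hlt hin hout using hex
  have hpl : ∀ i < k, ℓ (p i) = i := by
    intro i hi
    have hi' := hp.mem i (by omega)
    exact hp.inj (by have := hlt _ (hKA hi'); omega) (by omega) (hin _ (hKA hi') hi')
  have hKK : ∀ i < k, ∀ j < k, (R (p i) (p j) ↔ i < j) := by
    intro i hi j hj
    refine ⟨fun hR => ?_, fun hij => hp.adj i j hij (by omega)⟩
    by_contra hij
    rcases (not_lt.1 hij).eq_or_lt with rfl | hlt
    · exact hKo _ (hp.mem _ (by omega)) _ (hp.mem _ (by omega)) hR hR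
    · exact hKo _ (hp.mem _ (by omega)) _ (hp.mem _ (by omega)) hR (hp.adj _ _ hlt (by omega))
  refine ⟨ℓ, hlt, fun u hu v hv => ?_, fun i hi j hj => ?_⟩
  · by_cases huK : u ∈ K <;> by_cases hvK : v ∈ K
    · have := hKK _ (hlt u hu) _ (hlt v hv)
      rwa [hin u hu huK, hin v hv hvK] at this
    · have := (h.twin hKA hK hp (mem_sdiff.2 ⟨hv, hvK⟩) (hout v hv hvK) _ (hlt u hu)).1
      rwa [hin u hu huK] at this
    · have := (h.twin hKA hK hp (mem_sdiff.2 ⟨hu, huK⟩) (hout u hu huK) _ (hlt v hv)).2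
      rwa [hin v hv hvK] at this
    · have hu' := mem_sdiff.2 ⟨hu, huK⟩
      have hv' := mem_sdiff.2 ⟨hv, hvK⟩
      by_cases huv : u = v
      · subst huv
        exact iff_of_false (fun c => h2 u hu' u hu' c c) (lt_irrefl _)
      have hlne : ℓ u ≠ ℓ v := fun he =>
        huv (h.missing_inj hKA hK hp hu' hv' (hout u hu huK) (he ▸ hout v hv hvK))
      have htw := h.twin hKA hK hp hu' (hout u hu huK)
      have hx := hp.mem (ℓ u) (by have := hlt u hu; omega)
      have hlu := hlt u hu
      have hlv := hlt v hv
      -- Two vertices outside are compared by exchanging `u` for its twin in `K`: `v` still misses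
      -- index `ℓ v` in the new list, so `twin` describes the arcs between `u` and `v`.
      set K' := insert u (K.erase (p (ℓ u))) with hK'
      have huL : u ∉ K.erase (p (ℓ u)) := fun c => huK (mem_of_mem_erase c)
      have cK' : K'.card = k := by
        rw [hK', card_insert_of_notMem huL, card_erase_add_one hx, hK]
      have hp' : IsTransEnum R (fun t => if t = ℓ u then u else p t) K' := by
        refine ⟨fun i j hij hj => ?_, fun i hi => ?_, fun w hw => ?_⟩
        · rw [cK'] at hj
          split_ifs with c1 c2 c2
          · omega
          · exact (htw j hj).2.2 (by omega)
          · exact (htw i (by omega)).1.2 (by omega)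
          · exact hp.adj _ _ hij (by omega)
        · rw [cK'] at hi
          split_ifs with c
          · exact mem_insert_self _ _
          · exact mem_insert_of_mem (mem_erase.2
              ⟨fun he => c (hp.inj (by omega) (by omega) he), hp.mem i (by omega)⟩)
        · rw [cK']
          rcases mem_insert.1 hw with rfl | hw
          · exact ⟨ℓ w, hlt w hu, by simp⟩
          · obtain ⟨i, hi, rfl⟩ := hp.surj w (mem_of_mem_erase hw)
            refine ⟨i, by omega, ?_⟩
            have : i ≠ ℓ u := fun he => ne_of_mem_erase hw (by rw [he])
            simp [this]
      have hKA' : K' ⊆ A := insert_subset hu ((erase_subset _ _).trans hKA)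
      have hvK' : v ∈ A \ K' := by
        refine mem_sdiff.2 ⟨hv, fun c => ?_⟩
        rcases mem_insert.1 c with c | c
        · exact huv c.symm
        · exact hvK (mem_of_mem_erase c)
      obtain ⟨y, hy⟩ := ((h.outside hKA' cK' hp').1 v hvK').2
      have htw' := h.twin hKA' cK' hp' hvK' hy
      have hyv : y = ℓ v := by
        have e1 := htw' (ℓ v) hlv
        simp only [if_neg hlne.symm] at e1
        have e2 := (hout v hv hvK).2.1
        have e3 := (hout v hv hvK).2.2.1
        have e4 := mt e1.1.2 e3
        have e5 := mt e1.2.2 e2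
        omega
      have := (htw' (ℓ u) hlu).1
      rwa [hyv, if_pos rfl] at this
  · have hone : 1 ≤ (A.filter fun v => ℓ v = j).card :=
      card_pos.2 ⟨p j, mem_filter.2 ⟨hKA (hp.mem j (by omega)), hpl j hj⟩⟩
    have htwo : (A.filter fun v => ℓ v = i).card ≤ 2 := by
      have hs : (A.filter fun v => ℓ v = i) ⊆
          insert (p i) ((A \ K).filter fun v => ℓ v = i) := by
        intro v hv
        obtain ⟨hvA, hvi⟩ := mem_filter.1 hv
        by_cases hvK : v ∈ K
        · rw [← hin v hvA hvK, hvi]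
          exact mem_insert_self _ _
        · exact mem_insert_of_mem (mem_filter.2 ⟨mem_sdiff.2 ⟨hvA, hvK⟩, hvi⟩)
      have h1 : ((A \ K).filter fun v => ℓ v = i).card ≤ 1 := by
        refine card_le_one.2 fun v hv w hw => ?_
        obtain ⟨hvW, hvi⟩ := mem_filter.1 hv
        obtain ⟨hwW, hwi⟩ := mem_filter.1 hw
        have mv := hout v (mem_sdiff.1 hvW).1 (mem_sdiff.1 hvW).2
        have mw := hout w (mem_sdiff.1 hwW).1 (mem_sdiff.1 hwW).2
        rw [hvi] at mv
        rw [hwi] at mw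
        exact h.missing_inj hKA hK hp hvW hwW mv mw
      have h2 := card_le_card hs
      have h3 := card_insert_le (p i) ((A \ K).filter fun v => ℓ v = i)
      omega
    omega

end Extremal

/-! ### Adding a vertex to a leveled digraph -/

section Leveled

variable {V : Type*} {R : V → V → Prop} {k : ℕ} {B : Finset V} {ℓ : V → ℕ}

theorem IsLeveled.sum_card (hB : IsLeveled R k B ℓ) :
    ∑ j ∈ range k, (B.filter fun v => ℓ v = j).card = B.card :=
  (card_eq_sum_card_fiberwise fun v hv => by simpa using hB.lt v hv).symm

/-- The sizes of the levels. -/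
theorem IsLeveled.card_level (hB : IsLeveled R k B ℓ) {j : ℕ} (hj : j < k) :
    B.card / k ≤ (B.filter fun v => ℓ v = j).card ∧
      (B.filter fun v => ℓ v = j).card ≤ B.card / k + 1 := by
  have hs := hB.sum_card
  have hm := Nat.div_add_mod B.card k
  have hlt := Nat.mod_lt B.card (show 0 < k by omega)
  have hjm : j ∈ range k := mem_range.2 hj
  have hcard : ((range k).erase j).card + 1 = k := by rw [card_erase_add_one hjm, card_range]
  rw [← add_sum_erase _ _ hjm] at hs
  set g : ℕ → ℕ := fun j => (B.filter fun v => ℓ v = j).card with hg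
  set q := B.card / k
  have hk' : k * q = ((range k).erase j).card * q + q := by rw [← Nat.succ_mul]; congr 1; omega
  change q ≤ g j ∧ g j ≤ q + 1
  change g j + ∑ i ∈ (range k).erase j, g i = B.card at hs
  constructor
  · by_contra! hcon
    have : ∑ i ∈ (range k).erase j, g i ≤ ((range k).erase j).card * q := by
      rw [← smul_eq_mul, ← sum_const]
      exact sum_le_sum fun i hi => by
        have : g i ≤ g j + 1 := hB.balanced i (mem_range.1 (mem_of_mem_erase hi)) j hj
        omega
    omega
  · by_contra! hcon
    have : ((range k).erase j).card * (q + 1) ≤ ∑ i ∈ (range k).erase j, g i := by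
      rw [← smul_eq_mul, ← sum_const]
      exact sum_le_sum fun i hi => by
        have : g j ≤ g i + 1 := hB.balanced j hj i (mem_range.1 (mem_of_mem_erase hi))
        omega
    rw [mul_add, mul_one] at this
    omega

theorem IsLeveled.exists_rep (hB : IsLeveled R k B ℓ) (hk0 : 0 < k) (hk : k ≤ B.card) :
    ∃ p : ℕ → V, ∀ j < k, p j ∈ B ∧ ℓ (p j) = j := by
  have : ∀ j, ∃ v, j < k → v ∈ B ∧ ℓ v = j := by
    intro j
    by_cases hj : j < k
    · have h1 := (hB.card_level hj).1
      have h2 : 1 ≤ B.card / k := (Nat.one_le_div_iff hk0).2 hk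
      obtain ⟨v, hv⟩ := card_pos.1 (by omega : 0 < (B.filter fun v => ℓ v = j).card)
      exact ⟨v, fun _ => mem_filter.1 hv⟩
    · obtain ⟨v, -⟩ := card_pos.1 (by omega : 0 < B.card)
      exact ⟨v, fun c => (hj c).elim⟩
  choose p hp using this
  exact ⟨p, hp⟩

/-- The in-neighbours of a further vertex lie on lower levels than its out-neighbours. -/
theorem IsLeveled.lt_of_adj (hB : IsLeveled R k B ℓ) (h : WalkUnique R k) (hk : 5 ≤ k)
    (hkB : k ≤ B.card) {u v w : V} (hu : u ∈ B) (hw : w ∈ B) (huv : R u v) (hvw : R v w) :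
    ℓ u < ℓ w := by
  by_contra hcon
  obtain ⟨p, hp⟩ := hB.exists_rep (by omega) hkB
  have hadj : ∀ i j, i < j → j < k → R (p i) (p j) := fun i j hij hj => by
    rw [hB.adj _ (hp i (by omega)).1 _ (hp j hj).1, (hp i (by omega)).2, (hp j hj).2]
    exact hij
  have hne : ∀ i, i + 1 < k → p i ≠ p (i + 1) := fun i hi he => by
    have := (hp i (by omega)).2
    rw [he, (hp _ hi).2] at this
    omega
  have hlu := hB.lt u hu
  have hpu : ∀ t < ℓ u, R (p t) u := fun t ht => by
    rwa [hB.adj _ (hp t (by omega)).1 _ hu, (hp t (by omega)).2]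
  have hpw : ∀ t, ℓ w < t → t < k → R w (p t) := fun t ht ht' => by
    rwa [hB.adj _ hw _ (hp t ht').1, (hp t ht').2]
  have hpne : ∀ t < ℓ u, p t ≠ u := fun t ht he => by
    have := (hp t (by omega)).2
    rw [he] at this
    omega
  rcases (not_lt.1 hcon).eq_or_lt with he | hlt
  · exact h.not_detour hk hadj hne hlu huv hvw hpu (fun t ht => hpw t (by omega))
      (fun t ht => hpne t (by omega))
  · exact h.not_detour hk hadj hne (show ℓ w + 1 < k by omega) huv hvw
      (fun t ht => hpu t (by omega)) (fun t ht => hpw t (by omega))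
      (fun t ht => hpne t (by omega))

/-- A further vertex cannot be inserted between two consecutive levels, before all levels or
behind all levels. -/
theorem IsLeveled.not_insert (hB : IsLeveled R k B ℓ) (h : WalkUnique R k) (hk : 5 ≤ k)
    (hkB : k + 5 ≤ B.card) {v : V} {a : ℕ} (ha : a ≤ k)
    (hin : 0 < a → ∃ u ∈ B, ℓ u + 1 = a ∧ R u v) (hout : a < k → ∃ w ∈ B, ℓ w = a ∧ R v w) :
    False := by
  classical
  -- A level with two vertices, where the choice affects neither the ends of the walk nor the
  -- neighbours of `v` on it. If at most the four excluded levels had two vertices, balance would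
  -- leave at most `k + 4` vertices in all.
  obtain ⟨j, hj, hja, hja', hj0, hjk, hj2⟩ : ∃ j < k, j + 1 ≠ a ∧ j ≠ a ∧ j ≠ 0 ∧ j + 1 ≠ k ∧
      1 < (B.filter fun v => ℓ v = j).card := by
    by_contra! hcon
    set X : Finset ℕ := {a - 1, a, 0, k - 1} with hX
    have hX4 : X.card ≤ 4 := card_le_four
    have hout : ∀ j < k, j ∉ X → (B.filter fun v => ℓ v = j).card ≤ 1 := by
      intro j hj hjX
      simp only [hX, mem_insert, mem_singleton, not_or] at hjX
      exact hcon j hj (by omega) (by omega) (by omega) (by omega)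
    obtain ⟨i, hi, hiX⟩ : ∃ i ∈ range k, i ∉ X :=
      exists_mem_notMem_of_card_lt_card (by rw [card_range]; omega)
    rw [mem_range] at hi
    have htwo : ∀ j < k, (B.filter fun v => ℓ v = j).card ≤ 2 := fun j hj => by
      have := hB.balanced j hj i hi
      have := hout i hi hiX
      omega
    have h1 : ∑ j ∈ range k, (B.filter fun v => ℓ v = j).card ≤
        ∑ j ∈ range k, (1 + if j ∈ X then 1 else 0) := by
      refine sum_le_sum fun j hj => ?_
      rw [mem_range] at hj
      split_ifs with c
      · exact htwo j hj
      · exact hout j hj c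
    rw [hB.sum_card, sum_add_distrib, sum_const, card_range, smul_eq_mul, mul_one,
      ← card_filter] at h1
    have h2 : ((range k).filter fun j => j ∈ X).card ≤ X.card :=
      card_le_card fun j hj => (mem_filter.1 hj).2
    omega
  obtain ⟨y, hy, y', hy', hne⟩ := one_lt_card.1 hj2
  rw [mem_filter] at hy hy'
  obtain ⟨p, hp⟩ := hB.exists_rep (by omega) (by omega)
  obtain ⟨p, hp, hpin, hpout⟩ : ∃ p : ℕ → V, (∀ j < k, p j ∈ B ∧ ℓ (p j) = j) ∧
      (∀ t, t + 1 = a → R (p t) v) ∧ (a < k → R v (p a)) := by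
    have hin' : ∃ u, 0 < a → u ∈ B ∧ ℓ u + 1 = a ∧ R u v := by
      by_cases c : 0 < a
      · obtain ⟨u, hu⟩ := hin c
        exact ⟨u, fun _ => hu⟩
      · exact ⟨v, fun c' => (c c').elim⟩
    have hout' : ∃ u, a < k → u ∈ B ∧ ℓ u = a ∧ R v u := by
      by_cases c : a < k
      · obtain ⟨u, hu⟩ := hout c
        exact ⟨u, fun _ => hu⟩
      · exact ⟨v, fun c' => (c c').elim⟩
    obtain ⟨u, hu⟩ := hin'
    obtain ⟨w, hw⟩ := hout'
    refine ⟨fun t => if t + 1 = a then u else if t = a then w else p t, fun t ht => ?_,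
      fun t ht => ?_, fun hak => ?_⟩
    · beta_reduce
      split_ifs with c1 c2
      · have := hu (by omega)
        exact ⟨this.1, by omega⟩
      · have := hw (by omega)
        exact ⟨this.1, by omega⟩
      · exact hp t ht
    · simpa [ht] using (hu (by omega)).2.2
    · simpa using (hw hak).2.2
  -- The walk through all levels with `v` inserted before level `a` has length `k`; the vertex `z`
  -- on level `j` can be chosen in two ways.
  have key : ∀ z, z ∈ B → ℓ z = j → ∀ t < k,
      R ((fun t => if t < a then (if t = j then z else p t) else if t = a then v
          else (if t = j + 1 then z else p (t - 1))) t)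
        ((fun t => if t < a then (if t = j then z else p t) else if t = a then v
          else (if t = j + 1 then z else p (t - 1))) (t + 1)) := by
    intro z hz hzj
    have hz' : ∀ t < k, (if t = j then z else p t) ∈ B ∧ ℓ (if t = j then z else p t) = t := by
      intro t ht
      split_ifs with c
      · exact ⟨hz, by omega⟩
      · exact hp t ht
    have hadj : ∀ t, t + 1 < k →
        R (if t = j then z else p t) (if t + 1 = j then z else p (t + 1)) := by
      intro t ht
      rw [hB.adj _ (hz' t (by omega)).1 _ (hz' (t + 1) ht).1, (hz' t (by omega)).2,
        (hz' (t + 1) ht).2]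
      omega
    intro t ht
    rcases (show t + 1 < a ∨ t + 1 = a ∨ t = a ∨ a < t by omega) with c | c | rfl | c
    · simpa [c, show t < a by omega] using hadj t (by omega)
    · have : t ≠ j := by omega
      simpa [c, show t < a by omega, this] using hpin t c
    · have : t ≠ j := by omega
      simpa [this] using hpout ht
    · obtain ⟨s, rfl⟩ : ∃ s, t = s + 1 := ⟨t - 1, by omega⟩
      simpa [show ¬ s + 1 < a by omega, show ¬ s + 1 + 1 < a by omega, show s + 1 ≠ a by omega,
        show s + 1 + 1 ≠ a by omega] using hadj s (by omega)
  have heq := h _ _ (key y hy.1 hy.2) (key y' hy'.1 hy'.2) (by simp [hj0.symm])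
    (by simp [show k ≠ j by omega, show k ≠ j + 1 by omega])
  apply hne
  rcases lt_or_ge j a with c | c
  · simpa [c] using heq j (by omega)
  · simpa [show ¬ j + 1 < a by omega, show j + 1 ≠ a by omega] using heq (j + 1) (by omega)

variable [DecidableEq V]

/-- A vertex of large degree can be added to one of the levels. -/
theorem IsLeveled.exists_insert (hB : IsLeveled R k B ℓ) (h : WalkUnique R k) (hk : 5 ≤ k)
    (hkB : k + 5 ≤ B.card) {v : V} (hv : v ∉ B)
    (hd : B.card ≤ deg R v B + ind R v v + B.card / k) : ∃ ℓ', IsLeveled R k (insert v B) ℓ' := by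
  classical
  have hlt := fun u (hu : u ∈ B) w (hw : w ∈ B) =>
    hB.lt_of_adj h hk (by omega) (v := v) hu hw
  -- A vertex with a loop is joined, in each direction, to vertices of at most one level, so its
  -- degree is too small.
  have hloop : ¬ R v v := by
    intro hvv
    have hne : ∀ u ∈ B, u ≠ v := fun u hu he => hv (he ▸ hu)
    have hin : ∀ u ∈ B, ∀ w ∈ B, R u v → R w v → ¬ ℓ u < ℓ w := fun u hu w hw h1 h2 hl =>
      hne w hw (h.two (by omega) (.of_loop hvv) ((hB.adj u hu w hw).2 hl) h2 h1 hvv)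
    have hout : ∀ u ∈ B, ∀ w ∈ B, R v u → R v w → ¬ ℓ u < ℓ w := fun u hu w hw h1 h2 hl =>
      hne u hu (h.flip.two (by omega) (Escapes.of_loop hvv)
        (show R u w from (hB.adj u hu w hw).2 hl) h1 h2 hvv)
    have hle : ∀ P : V → Prop, (∀ u ∈ B, ∀ w ∈ B, P u → P w → ¬ ℓ u < ℓ w) →
        ∑ u ∈ B, (if P u then 1 else 0) ≤ B.card / k + 1 := by
      intro P hP
      rw [← card_filter]
      by_cases hex : ∃ u ∈ B, P u
      · obtain ⟨u, hu, hPu⟩ := hex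
        refine le_trans (card_le_card fun w hw => ?_) (hB.card_level (hB.lt u hu)).2
        obtain ⟨hwB, hPw⟩ := mem_filter.1 hw
        have := hP u hu w hwB hPu hPw
        have := hP w hwB u hu hPw hPu
        exact mem_filter.2 ⟨hwB, by omega⟩
      · push Not at hex
        rw [filter_false_of_mem hex]
        simp
    have h1 : ∑ u ∈ B, ind R v u ≤ B.card / k + 1 := hle _ hout
    have h2 : ∑ u ∈ B, ind R u v ≤ B.card / k + 1 := hle _ hin
    have h3 : deg R v B = ∑ u ∈ B, ind R v u + ∑ u ∈ B, ind R u v := sum_add_distrib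
    have h4 := ind_le_one (R := R) v v
    have h5 := Nat.mul_div_le B.card k
    have h6 : 5 * (B.card / k) ≤ k * (B.card / k) := Nat.mul_le_mul_right _ hk
    omega
  have hboth : ∀ u ∈ B, R u v → ¬ R v u := fun u hu h1 h2 => (hlt u hu u hu h1 h2).false
  obtain ⟨a, hak, ha, hain, haout⟩ : ∃ a ≤ k, (0 < a → ∃ u ∈ B, ℓ u + 1 = a ∧ R u v) ∧
      (∀ u ∈ B, R u v → ℓ u < a) ∧ ∀ w ∈ B, R v w → a ≤ ℓ w := by
    by_cases hex : ∃ u ∈ B, R u v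
    · obtain ⟨u, hu, hum⟩ := exists_max_image (B.filter fun u => R u v) ℓ (by
        obtain ⟨u, hu, huv⟩ := hex
        exact ⟨u, mem_filter.2 ⟨hu, huv⟩⟩)
      obtain ⟨huB, huv⟩ := mem_filter.1 hu
      exact ⟨ℓ u + 1, hB.lt u huB, fun _ => ⟨u, huB, rfl, huv⟩,
        fun w hw hwv => Nat.lt_succ_of_le (hum w (mem_filter.2 ⟨hw, hwv⟩)),
        fun w hw hvw => hlt u huB w hw huv hvw⟩
    · push Not at hex
      exact ⟨0, by omega, fun c => (lt_irrefl _ c).elim, fun u hu c => (hex u hu c).elim,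
        fun _ _ _ => Nat.zero_le _⟩
  -- By `not_insert` the vertex `v` has no arc to level `a`, so it is joined to nothing on this
  -- level. The degree bound then forces level `a` to have the smaller size and all arcs between `v`
  -- and the other levels to be present.
  obtain ⟨hak', hano⟩ : a < k ∧ ∀ w ∈ B, ℓ w = a → ¬ R v w := by
    by_contra hcon
    refine hB.not_insert h hk hkB hak ha fun hak' => ?_
    by_contra! hno
    exact hcon ⟨hak', hno⟩
  have hterm : ∀ u ∈ B, ind R v u + ind R u v ≤ if ℓ u = a then 0 else 1 := by
    intro u hu
    split_ifs with c
    · rw [ind_eq_zero.2 (hano u hu c), ind_eq_zero.2 fun c' => by have := hain u hu c'; omega]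
    · by_cases c' : R u v
      · rw [ind_eq_zero.2 (hboth u hu c'), zero_add]
        exact ind_le_one _ _
      · rw [ind_eq_zero.2 c', add_zero]
        exact ind_le_one _ _
  have hsum : ∑ u ∈ B, (if ℓ u = a then 0 else 1) + (B.filter fun v => ℓ v = a).card = B.card := by
    rw [card_filter, ← sum_add_distrib, card_eq_sum_ones]
    exact sum_congr rfl fun u _ => by split_ifs <;> rfl
  obtain ⟨hqa, -⟩ := hB.card_level hak'
  have hle : deg R v B ≤ ∑ u ∈ B, (if ℓ u = a then 0 else 1) := sum_le_sum hterm
  rw [ind_eq_zero.2 hloop] at hd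
  have heq : deg R v B = ∑ u ∈ B, (if ℓ u = a then 0 else 1) := by omega
  have hall := (sum_eq_sum_iff_of_le hterm).1 heq
  have hqa' : (B.filter fun v => ℓ v = a).card = B.card / k := by omega
  have hin : ∀ u ∈ B, (R u v ↔ ℓ u < a) := by
    refine fun u hu => ⟨hain u hu, fun hl => ?_⟩
    have h1 := hall u hu
    rw [if_neg hl.ne, ind_eq_zero.2 fun c => by have := haout u hu c; omega, zero_add] at h1
    exact ind_eq_one.1 h1
  have hout : ∀ u ∈ B, (R v u ↔ a < ℓ u) := by
    refine fun u hu => ⟨fun c => ?_, fun hl => ?_⟩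
    · exact lt_of_le_of_ne (haout u hu c) fun he => hano u hu he.symm c
    · have h1 := hall u hu
      rw [if_neg hl.ne', (ind_eq_zero (R := R) (u := u)).2 fun c => by have := hain u hu c; omega,
        add_zero] at h1
      exact ind_eq_one.1 h1
  have hl' : ∀ u ∈ B, Function.update ℓ v a u = ℓ u := fun u hu =>
    Function.update_of_ne (fun he => hv (by rwa [← he])) _ _
  have hcard : ∀ i < k, B.card / k ≤
      ((insert v B).filter fun u => Function.update ℓ v a u = i).card ∧
      ((insert v B).filter fun u => Function.update ℓ v a u = i).card ≤ B.card / k + 1 := by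
    intro i hi
    have hf : (B.filter fun u => Function.update ℓ v a u = i) = B.filter fun u => ℓ u = i :=
      filter_congr fun u hu => by rw [hl' u hu]
    rw [filter_insert, Function.update_self, hf]
    split_ifs with c
    · subst c
      rw [card_insert_of_notMem fun c => hv (mem_filter.1 c).1, hqa']
      omega
    · exact hB.card_level hi
  refine ⟨Function.update ℓ v a, fun u hu => ?_, fun u hu w hw => ?_, fun i hi j hj => ?_⟩
  · rcases mem_insert.1 hu with rfl | hu
    · simpa using hak'
    · rw [hl' u hu]
      exact hB.lt u hu
  · rcases mem_insert.1 hu with rfl | hu' <;> rcases mem_insert.1 hw with rfl | hw'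
    · exact iff_of_false hloop (lt_irrefl _)
    · rw [hl' w hw', Function.update_self]
      exact hout w hw'
    · rw [hl' u hu', Function.update_self]
      exact hin u hu'
    · rw [hl' u hu', hl' w hw']
      exact hB.adj u hu' w hw'
  · have := hcard i hi
    have := hcard j hj
    omega

/-- The vertex to delete is chosen so that the rest is extremal again; with a loop counted once, it
takes exactly `n - n / k` arcs with it. -/
theorem WalkUnique.exists_isLeveled (h : WalkUnique R k) (hk : 5 ≤ k) {n : ℕ} (hn : k + 5 ≤ n)
    {A : Finset V} (hA : A.card = n) (he : arcs R A = turanSize k n) : ∃ ℓ, IsLeveled R k A ℓ := by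
  induction n, hn using Nat.le_induction generalizing A with
  | base =>
    have h2 := turanSize_add (k := k) 5 hk
    exact IsExtremalFive.exists_isLeveled ⟨h, hk, hA, by omega⟩
  | succ n hn ih =>
    obtain ⟨v, hv, hvA⟩ := exists_erase_turanSize (R := R) (e := 0) (by omega) hA (by omega)
      (by omega) he.ge
    have hc : (A.erase v).card = n := by have := card_erase_add_one hv; omega
    have hle := h.arcs_le_turanSize (by omega) (by omega) hc
    obtain ⟨ℓ, hl⟩ := ih hc (by omega)
    have h1 := arcs_erase (R := R) hv
    rw [he, turanSize] at h1
    have := Nat.div_le_self n k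
    have := hl.exists_insert h hk (by omega) (notMem_erase v A) (by rw [hc]; omega)
    rwa [insert_erase hv] at this

end Leveled

/-! ### Leveled digraphs and completely transitive tournaments -/

section Size

variable {V : Type*} {R : V → V → Prop} {k : ℕ} {A : Finset V} {ℓ : V → ℕ}

theorem IsLeveled.arcs_eq (hA : IsLeveled R k A ℓ) (hk : 0 < k) :
    arcs R A = turanSize k A.card := by
  set g : ℕ → ℕ := fun j => (A.filter fun v => ℓ v = j).card with hg
  set q := A.card / k with hq
  have h1 : 2 * arcs R A + ∑ j ∈ range k, g j * g j = A.card ^ 2 := by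
    have e1 : ∑ u ∈ A, ∑ v ∈ A, (ind R u v + ind R v u + if ℓ v = ℓ u then 1 else 0) =
        A.card ^ 2 := by
      rw [sq, ← smul_eq_mul, ← sum_const]
      refine sum_congr rfl fun u hu => ?_
      rw [card_eq_sum_ones]
      refine sum_congr rfl fun v hv => ?_
      have a1 := hA.adj u hu v hv
      have a2 := hA.adj v hv u hu
      rcases lt_trichotomy (ℓ u) (ℓ v) with c | c | c
      · rw [ind_eq_one.2 (a1.2 c), ind_eq_zero.2 (fun c' => c.asymm (a2.1 c')), if_neg c.ne']
      · rw [ind_eq_zero.2 (fun c' => (a1.1 c').ne c), ind_eq_zero.2 (fun c' => (a2.1 c').ne c.symm),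
          if_pos c.symm]
      · rw [ind_eq_one.2 (a2.2 c), ind_eq_zero.2 (fun c' => c.asymm (a1.1 c')), if_neg c.ne]
    have e2 : ∑ u ∈ A, ∑ v ∈ A, (if ℓ v = ℓ u then 1 else 0) = ∑ j ∈ range k, g j * g j := by
      rw [← sum_fiberwise_of_maps_to (s := A) (t := range k) (g := ℓ)
        fun v hv => mem_range.2 (hA.lt v hv)]
      refine sum_congr rfl fun j _ => ?_
      rw [← smul_eq_mul, ← sum_const]
      refine sum_congr rfl fun u hu => ?_
      rw [← card_filter, (mem_filter.1 hu).2]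
    have e3 : ∑ u ∈ A, ∑ v ∈ A, ind R v u = arcs R A := sum_comm
    simp only [sum_add_distrib] at e1
    rw [e2, e3] at e1
    change arcs R A + arcs R A + _ = _ at e1
    omega
  -- Each level size is a root of `(g - q)(g - q - 1)`, which makes the sum of squares linear in the
  -- sizes.
  have h2 : ∑ j ∈ range k, g j * g j + k * (q * (q + 1)) = (2 * q + 1) * A.card := by
    have e1 : ∑ j ∈ range k, g j = A.card := hA.sum_card
    rw [← e1, mul_sum]
    have e2 : ∑ j ∈ range k, (q * (q + 1)) = k * (q * (q + 1)) := by
      rw [sum_const, card_range, smul_eq_mul]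
    rw [← e2, ← sum_add_distrib]
    refine sum_congr rfl fun j hj => ?_
    obtain ⟨c1, c2⟩ := hA.card_level (mem_range.1 hj)
    change q ≤ g j at c1
    change g j ≤ q + 1 at c2
    rcases (show g j = q ∨ g j = q + 1 by omega) with c | c <;> rw [c] <;> ring
  have h3 := two_mul_turanSize hk A.card
  have h4 := Nat.div_add_mod A.card k
  rw [← hq] at h3 h4
  have h5 : q * A.card = q * (k * q + A.card % k) := by rw [h4]
  nlinarith

/-- Levels rise strictly along a walk, so a walk of length `k` would need `k + 1` of them. -/
theorem IsLeveled.isFree {D : Digraph V} [Fintype V] (h : IsLeveled D.Adj k univ ℓ) :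
    IsFree D k := by
  rintro ⟨p, -, hp, -⟩
  have key : ∀ i (hi : i < k + 1), i ≤ ℓ (p ⟨i, hi⟩) := by
    intro i
    induction i with
    | zero => exact fun _ => Nat.zero_le _
    | succ i ih =>
      intro hi
      have h1 := ih (by omega)
      have h2 := (h.adj _ (mem_univ _) _ (mem_univ _)).1 (hp ⟨i, by omega⟩)
      exact lt_of_le_of_lt h1 h2
  have h1 := key k (by omega)
  have h2 := h.lt (p ⟨k, by omega⟩) (mem_univ _)
  omega

theorem IsLeveled.isStrict {D : Digraph V} [Fintype V] (h : IsLeveled D.Adj k univ ℓ) :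
    IsStrict D := fun v hv => lt_irrefl _ ((h.adj v (mem_univ _) v (mem_univ _)).1 hv)

theorem size_eq_arcs [Fintype V] (D : Digraph V) : size D = arcs D.Adj univ := by
  classical
  unfold size arcs ind
  rw [Set.ncard_eq_toFinset_card', ← sum_product', univ_product_univ, ← card_filter]
  congr 1
  ext
  simp

/-- The sizes of the levels of a completely transitive tournament. -/
theorem card_deletion_level {s k : ℕ} {α : Finset (Fin (s + 1) × Fin k)}
    (hα : ∀ x ∈ α, x.1 = Fin.last s) (j : Fin k) :
    Nat.card {y : {x // x ∉ α} // y.1.2 = j} = if (Fin.last s, j) ∈ α then s else s + 1 := by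
  classical
  have e : {y : {x // x ∉ α} // y.1.2 = j} ≃ {c : Fin (s + 1) // (c, j) ∉ α} :=
    { toFun := fun y => ⟨y.1.1.1, fun hc => y.1.2 <|
        (congrArg (· ∈ α) (Prod.ext rfl y.2 : y.1.1 = (y.1.1.1, j))).mpr hc⟩
      invFun := fun c => ⟨⟨(c.1, j), c.2⟩, rfl⟩
      left_inv := fun y => Subtype.ext (Subtype.ext (Prod.ext rfl y.2.symm))
      right_inv := fun _ => rfl }
  rw [Nat.card_congr e, Nat.card_eq_fintype_card, Fintype.card_subtype]
  split_ifs with h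
  · have : (univ.filter fun c => (c, j) ∉ α) = univ.erase (Fin.last s) := by
      ext c
      simp only [mem_filter, mem_univ, true_and, mem_erase, and_true]
      exact ⟨fun hc he => hc (he ▸ h), fun hc hc' => hc (hα _ hc')⟩
    rw [this, card_erase_of_mem (mem_univ _), card_univ, Fintype.card_fin, Nat.add_sub_cancel]
  · rw [filter_true_of_mem, card_univ, Fintype.card_fin]
    intro c _ hc
    have : c = Fin.last s := hα _ hc
    exact h (this ▸ hc)

theorem adjMatrix_eq_iff {s k : ℕ} {α : Finset (Fin (s + 1) × Fin k)} (D : Digraph V)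
    (e : V ≃ {x // x ∉ α}) : adjMatrix D = (deletion (Pi (s + 1) k) α).submatrix e e ↔
      ∀ u v, D.Adj u v ↔ (e u).1.2 < (e v).1.2 := by
  rw [← Matrix.ext_iff]
  refine forall₂_congr fun u v => ?_
  have : (deletion (Pi (s + 1) k) α).submatrix e e u v =
      if (e u).1.2 < (e v).1.2 then 1 else 0 := by
    simp [deletion, Pi, J, T, Matrix.kroneckerMap_apply]
  rw [this]
  unfold adjMatrix
  rw [Matrix.of_apply]
  split_ifs <;> simp [*]

theorem IsCompletelyTransitive.exists_isLeveled [Fintype V] {D : Digraph V} {s k t : ℕ}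
    (h : IsCompletelyTransitive s k t D) : ∃ ℓ, IsLeveled D.Adj k univ ℓ := by
  classical
  obtain ⟨α, hα, -, e, he⟩ := h
  rw [adjMatrix_eq_iff] at he
  have hcard : ∀ j : Fin k, (univ.filter fun v => ((e v).1.2 : ℕ) = j).card =
      if (Fin.last s, j) ∈ α then s else s + 1 := by
    intro j
    rw [← card_deletion_level hα j, ← Fintype.card_subtype, ← Nat.card_eq_fintype_card]
    exact Nat.card_congr (e.subtypeEquiv fun v => Fin.ext_iff.symm)
  refine ⟨fun v => ((e v).1.2 : ℕ), fun v _ => (e v).1.2.2, fun u _ v _ => he u v,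
    fun i hi j hj => ?_⟩
  have h1 := hcard ⟨i, hi⟩
  have h2 := hcard ⟨j, hj⟩
  simp only at h1 h2
  rw [h1, h2]
  split_ifs <;> omega

theorem IsLeveled.isCompletelyTransitive [Fintype V] {D : Digraph V} {s k t : ℕ}
    (h : IsLeveled D.Adj k univ ℓ) (hV : Fintype.card V = s * k + t) (ht : t < k) :
    IsCompletelyTransitive s k t D := by
  classical
  have hk : 0 < k := by omega
  set g : ℕ → ℕ := fun j => (univ.filter fun v => ℓ v = j).card with hg
  have hs : (univ : Finset V).card / k = s := by
    rw [card_univ, hV, mul_comm, Nat.mul_add_div hk, Nat.div_eq_of_lt ht, add_zero]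
  have hgs : ∀ j < k, s ≤ g j ∧ g j ≤ s + 1 := fun j hj => by
    have := h.card_level hj
    rwa [hs] at this
  -- The levels of size `s` lose their position in the last block. Then corresponding levels have
  -- equal size, and bijections between them combine to the renumbering.
  set α : Finset (Fin (s + 1) × Fin k) :=
    (univ.filter fun j : Fin k => g j = s).image fun j => (Fin.last s, j) with hαdef
  have hα : ∀ x ∈ α, x.1 = Fin.last s := by
    intro x hx
    obtain ⟨j, -, rfl⟩ := mem_image.1 hx
    rfl
  have hmem : ∀ j : Fin k, (Fin.last s, j) ∈ α ↔ g j = s := by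
    intro j
    simp [hαdef]
  have hαcard : α.card + t = k := by
    rw [hαdef, card_image_of_injective _ (Prod.mk_right_injective _), card_filter]
    have e1 : ∑ j : Fin k, g j = s * k + t := by
      rw [Fin.sum_univ_eq_sum_range, ← hV, ← card_univ]
      exact h.sum_card
    have e2 : ∑ j : Fin k, (g j + if g j = s then 1 else 0) = k * (s + 1) := by
      rw [sum_congr rfl (g := fun _ => s + 1), sum_const, card_univ, Fintype.card_fin, smul_eq_mul]
      intro j _
      have := hgs j j.2
      split_ifs <;> omega
    rw [sum_add_distrib, e1, mul_add, mul_one, mul_comm s k] at e2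
    omega
  have hfib : ∀ j : Fin k, Nonempty ({v : V // (⟨ℓ v, h.lt v (mem_univ v)⟩ : Fin k) = j} ≃
      {y : {x // x ∉ α} // y.1.2 = j}) := by
    intro j
    rw [← Finite.card_eq, card_deletion_level hα, Nat.card_eq_fintype_card, Fintype.card_subtype]
    have : (univ.filter fun v => (⟨ℓ v, h.lt v (mem_univ v)⟩ : Fin k) = j).card = g j := by
      simp only [hg, Fin.ext_iff]
    have h2 := hgs j j.2
    have h3 := hmem j
    rw [this]
    split_ifs with c
    · exact h3.1 c
    · have := mt h3.2 c
      omega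
  have hfib' := fun j => (hfib j).some
  refine ⟨α, hα, hαcard, Equiv.ofFiberEquiv (f := fun v => (⟨ℓ v, h.lt v (mem_univ v)⟩ : Fin k))
    (g := fun y : {x // x ∉ α} => y.1.2) hfib', ?_⟩
  rw [adjMatrix_eq_iff]
  intro u v
  rw [Equiv.ofFiberEquiv_map hfib' u, Equiv.ofFiberEquiv_map hfib' v]
  exact h.adj u (mem_univ _) v (mem_univ _)

theorem exists_isCompletelyTransitive {n s k t : ℕ} (hn : n = s * k + t) (ht : t < k) :
    ∃ D : Digraph (Fin n), IsCompletelyTransitive s k t D := by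
  classical
  set α : Finset (Fin (s + 1) × Fin k) :=
    (univ.filter fun j : Fin k => ¬ (j : ℕ) < t).image fun j => (Fin.last s, j) with hα
  have hcard : α.card + t = k := by
    rw [hα, card_image_of_injective _ (Prod.mk_right_injective _)]
    have e1 := card_filter_add_card_filter_not (s := (univ : Finset (Fin k))) fun j => (j : ℕ) < t
    rw [card_univ, Fintype.card_fin, Fin.card_filter_val_lt, min_eq_right ht.le] at e1
    omega
  have hc : Fintype.card (Fin n) = Fintype.card {x // x ∉ α} := by
    rw [Fintype.card_fin, Fintype.card_subtype_compl, Fintype.card_prod, Fintype.card_fin,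
      Fintype.card_fin, Fintype.card_coe, add_mul, one_mul, hn]
    omega
  have e := Fintype.equivOfCardEq hc
  refine ⟨⟨fun u v => (e u).1.2 < (e v).1.2⟩, α, fun x hx => ?_, hcard, e, ?_⟩
  · obtain ⟨j, -, rfl⟩ := mem_image.1 hx
    rfl
  · exact (adjMatrix_eq_iff _ e).2 fun _ _ => Iff.rfl

theorem IsCompletelyTransitive.size_eq {n s k t : ℕ} (ht : t < k) {D : Digraph (Fin n)}
    (h : IsCompletelyTransitive s k t D) : D ∈ strictFree n k ∧ size D = turanSize k n := by
  obtain ⟨ℓ, hl⟩ := h.exists_isLeveled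
  refine ⟨⟨hl.isStrict, hl.isFree⟩, ?_⟩
  rw [size_eq_arcs, hl.arcs_eq (by omega), card_univ, Fintype.card_fin]

/-- Any class between the strict and all free digraphs will do, as the examples are strict and the
bound holds with loops; this serves both versions. -/
theorem maxSize_eq {n s k t : ℕ} (hn : n = s * k + t) (ht : t < k) (hk : 4 ≤ k)
    (hnk : k + 4 ≤ n) {𝒞 : Set (Digraph (Fin n))} (h1 : strictFree n k ⊆ 𝒞)
    (h2 : 𝒞 ⊆ free n k) : maxSize 𝒞 = turanSize k n := by
  obtain ⟨D, hD⟩ := exists_isCompletelyTransitive hn ht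
  obtain ⟨hD1, hD2⟩ := hD.size_eq ht
  refine (isGreatest_maxSize ⟨D, h1 hD1⟩).unique ⟨⟨D, h1 hD1, hD2⟩, ?_⟩
  rintro _ ⟨E, hE, rfl⟩
  rw [size_eq_arcs]
  exact (IsFree.walkUnique (h2 hE)).arcs_le_turanSize hk hnk (by simp)

theorem mem_extremal_iff {n s k t : ℕ} (hn : n = s * k + t) (ht : t < k) (hk : 5 ≤ k)
    (hnk : k + 5 ≤ n) {𝒞 : Set (Digraph (Fin n))} (h1 : strictFree n k ⊆ 𝒞)
    (h2 : 𝒞 ⊆ free n k) (D : Digraph (Fin n)) :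
    D ∈ extremal 𝒞 ↔ IsCompletelyTransitive s k t D := by
  have hmax := maxSize_eq hn ht (by omega) (by omega) h1 h2
  constructor
  · rintro ⟨hD, hs⟩
    rw [hmax, size_eq_arcs] at hs
    obtain ⟨ℓ, hl⟩ := (IsFree.walkUnique (h2 hD)).exists_isLeveled hk hnk (by simp) hs
    exact hl.isCompletelyTransitive (by rw [Fintype.card_fin, hn]) ht
  · intro hD
    obtain ⟨hD1, hD2⟩ := hD.size_eq ht
    exact ⟨h1 hD1, by rw [hmax, hD2]⟩

end Size

end WalkTuran

theorem theorem2p1 (n s k t : ℕ) (hn : n = s * k + t) (ht : t < k) :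
    (n ≥ k + 4 → k + 4 ≥ 8 →
      (WalkTuran.ex n k : ℤ) = (n.choose 2 : ℤ) - (s.choose 2 : ℤ) * k - s * t ∧
      (WalkTuran.exLoop n k : ℤ) = (n.choose 2 : ℤ) - (s.choose 2 : ℤ) * k - s * t) ∧
    (n ≥ k + 5 → k + 5 ≥ 10 →
      (∀ D : Digraph (Fin n),
        D ∈ WalkTuran.Ex n k ↔ WalkTuran.IsCompletelyTransitive s k t D) ∧
      (∀ D : Digraph (Fin n),
        D ∈ WalkTuran.ExLoop n k ↔ WalkTuran.IsCompletelyTransitive s k t D)) := by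
  have hsub := WalkTuran.strictFree_subset_free n k
  refine ⟨fun h1 h2 => ?_, fun h1 h2 => ⟨?_, ?_⟩⟩
  · rw [WalkTuran.ex, WalkTuran.exLoop,
      WalkTuran.maxSize_eq hn ht (by omega) h1 subset_rfl hsub,
      WalkTuran.maxSize_eq hn ht (by omega) h1 hsub subset_rfl]
    exact ⟨WalkTuran.turanSize_eq hn ht, WalkTuran.turanSize_eq hn ht⟩
  · exact WalkTuran.mem_extremal_iff hn ht (by omega) h1 subset_rfl hsub
  · exact WalkTuran.mem_extremal_iff hn ht (by omega) h1 hsub subset_rfl
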